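/- Let $q$ be a prime power, let $n\ge 2$ and $0\le d\le q$ be integers, and let $\mathbb{F}_{q^2}$ be the field with $q^2$ elements. A Hermitian matrix over $\mathbb{F}_{q^2}$ is a nonzero square matrix $H=(h_{ij})$ with $h_{ij}=h_{ji}^{\,q}$ for all $i,j$; its Hermitian variety is the projective zero set of the form $\sum_{i,j}h_{ij}x_ix_j^{\,q}$. Let $P\mathcal{U}_{n-1}\subset\mathbb{P}^n$ be the Hermitian variety of a Hermitian $(n+1)\times(n+1)$ matrix of rank $n$, and let $\mathcal{U}_{n-1}\subset\mathbb{P}^{n-1}$ be the Hermitian variety of an invertible Hermitian $n\times n$ matrix. For a form $G$ over $\mathbb{F}_{q^2}$ write $V(G)$ for its projective zero set, and put $$M_{n-1}(d)=\max_G |\mathcal{U}_{n-1}\cap V(G)(\mathbb{F}_{q^2})|,$$ where $G$ runs over the nonzero forms of degree $d$ in $\mathbb{F}_{q^2}[x_0,\dots,x_{n-1}]$. Let $\mathsf{P}_1,\dots,\mathsf{P}_m$ be an ordered list, without repetition, of all $\mathbb{F}_{q^2}$-rational points of $P\mathcal{U}_{n-1}$, each represented by the coordinate vector whose last nonzero coordinate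 is $1$, and let $C_d(P\mathcal{U}_{n-1})\subseteq\mathbb{F}_{q^2}^m$ be the linear code of all vectors $(G(\mathsf{P}_1),\dots,G(\mathsf{P}_m))$, where $G$ runs over the forms of degree $d$ in $\mathbb{F}_{q^2}[x_0,\dots,x_n]$ together with $0$. Then $C_d(P\mathcal{U}_{n-1})$ has length $$m=|P\mathcal{U}_{n-1}(\mathbb{F}_{q^2})|=1+q^2\,\frac{\left(q^{n-1}-(-1)^{n-1}\right)\left(q^n-(-1)^n\right)}{q^2-1},$$ dimension $\binom{n+d}{d}$ over $\mathbb{F}_{q^2}$, and its minimum distance $\mathsf{d}$ (the least Hamming weight of a nonzero codeword) satisfies $$\mathsf{d}\ \ge\ |P\mathcal{U}_{n-1}(\mathbb{F}_{q^2})|-\max\left\{|\mathcal{U}_{n-1}(\mathbb{F}_{q^2})|+(d-1)(q+1)q^{2n-4},\ 1+q^2M_{n-1}(d)\right\}.$$ -/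

import Mathlib

/-!
After a linear change of coordinates the variety of rank `n` in `ℙ^n` is the cone with vertex
`(1 : 0 : ⋯ : 0)` over the non-degenerate variety `𝓤` in `ℙ^(n-1)`, so its points are the vertex
and `q ^ 2` points over each point of `𝓤`. Expand a form `G` of degree `d` as a polynomial in the
coordinate `x₀`, with degree `j` and leading coefficient `g`, a form of degree `d - j`. Over a
point of `𝓤` outside `V(g)` the form `G` has at most `j` zeros, and over a point of `V(g)` at most
`q ^ 2`, so everything reduces to bounding `|𝓤 ∩ V(g)|`. For `j = 0` this is the definition of
`maxSection`, and for `n = 2` one has `|𝓤 ∩ V(g)| ≤ d - j`, while a product of `d` linear forms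
shows that `maxSection` is at least `d`. For `n ≥ 3` cut the cone of isotropic vectors by the
cosets of a plane spanned by an isotropic vector outside `V(g)` and an anisotropic vector
orthogonal to it. On each coset the Hermitian form and `g` have leading monomials that are powers
of different variables, so they have at most `(d - j) (q + 1)` common zeros, and only the origin
on the plane itself. Hence `|𝓤 ∩ V(g)| (q ^ 2 - 1) ≤ (d - j) (q + 1) (q ^ (2 n - 4) - 1)`.
-/

open scoped LinearAlgebra.Projectivization

namespace HermitianCode

noncomputable section

/-- `H` is a Hermitian matrix with respect to `x ↦ x ^ q`: it is nonzero and `h_ij = h_ji ^ q`. -/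
def IsHermitianMatrix {F ι : Type*} [Field F] (q : ℕ) (H : Matrix ι ι F) : Prop :=
  H ≠ 0 ∧ ∀ i j, H i j = H j i ^ q

/-- The form `xᵀ H x^(q) = ∑ h_ij x_i x_j ^ q`. -/
def hermitianForm {F : Type*} [Field F] (q : ℕ) {N : ℕ} (H : Matrix (Fin N) (Fin N) F) :
    MvPolynomial (Fin N) F :=
  ∑ i, ∑ j, MvPolynomial.C (H i j) * MvPolynomial.X i * MvPolynomial.X j ^ q

theorem exists_last_ne_zero {F : Type*} [Field F] [DecidableEq F] {N : ℕ}
    (P : ℙ F (Fin N → F)) : (Finset.univ.filter fun i => P.rep i ≠ 0).Nonempty := by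
  obtain ⟨i, hi⟩ := Function.ne_iff.mp P.rep_nonzero
  exact ⟨i, by simpa using hi⟩

open Classical in
/-- The index of the last nonzero homogeneous coordinate of a projective point. -/
def lastIndex {F : Type*} [Field F] {N : ℕ} (P : ℙ F (Fin N → F)) : Fin N :=
  (Finset.univ.filter fun i => P.rep i ≠ 0).max' (exists_last_ne_zero P)

/-- The coordinate vector of a projective point whose last nonzero coordinate is `1`. -/
def normRep {F : Type*} [Field F] {N : ℕ} (P : ℙ F (Fin N → F)) : Fin N → F :=
  (P.rep (lastIndex P))⁻¹ • P.rep

theorem rep_lastIndex_ne_zero {F : Type*} [Field F] {N : ℕ} (P : ℙ F (Fin N → F)) :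
    P.rep (lastIndex P) ≠ 0 := by
  classical
  have h := Finset.max'_mem _ (exists_last_ne_zero P)
  have h2 := (Finset.mem_filter.mp h).2
  unfold lastIndex
  convert h2

theorem normRep_lastIndex {F : Type*} [Field F] {N : ℕ} (P : ℙ F (Fin N → F)) :
    normRep P (lastIndex P) = 1 := by
  simp [normRep, rep_lastIndex_ne_zero P]

theorem normRep_of_lt {F : Type*} [Field F] {N : ℕ} (P : ℙ F (Fin N → F)) (j : Fin N)
    (hj : lastIndex P < j) : normRep P j = 0 := by
  classical
  by_contra h
  have hr : P.rep j ≠ 0 := fun h0 => h (by simp [normRep, h0])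
  refine absurd hj (not_lt.mpr ?_)
  exact Finset.le_max' _ j (by simpa using hr)

theorem normRep_ne_zero {F : Type*} [Field F] {N : ℕ} (P : ℙ F (Fin N → F)) :
    normRep P ≠ 0 := by
  intro h
  have := normRep_lastIndex P
  simp [h] at this

theorem mk_normRep {F : Type*} [Field F] {N : ℕ} (P : ℙ F (Fin N → F)) :
    Projectivization.mk F (normRep P) (normRep_ne_zero P) = P := by
  conv_rhs => rw [← P.mk_rep]
  rw [Projectivization.mk_eq_mk_iff']
  exact ⟨_, rfl⟩

/-- The set `V(G)(F)` of `F`-rational points of the projective zero set of a form `G`. -/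
def zeros {F : Type*} [Field F] {N : ℕ} (G : MvPolynomial (Fin N) F) : Set (ℙ F (Fin N → F)) :=
  {P | MvPolynomial.eval (normRep P) G = 0}

/-- The set of `F`-rational points of the Hermitian variety of the matrix `H`. -/
def hermitianVariety {F : Type*} [Field F] (q : ℕ) {N : ℕ} (H : Matrix (Fin N) (Fin N) F) :
    Set (ℙ F (Fin N → F)) :=
  zeros (hermitianForm q H)

/-- The maximal number of rational points that a hypersurface `V(G)` of degree `d` over `F`
has in common with `X`. -/
def maxSection {F : Type*} [Field F] {N : ℕ} (X : Set (ℙ F (Fin N → F))) (d : ℕ) : ℕ :=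
  sSup {k | ∃ G : MvPolynomial (Fin N) F,
    G ≠ 0 ∧ G.IsHomogeneous d ∧ k = Nat.card ↥(X ∩ zeros G)}

/-- The evaluation map `G ↦ (G(P_1), …, G(P_m))` on forms of degree `d`, where the points are
represented with last nonzero coordinate `1`. -/
def evalMap {F : Type*} [Field F] {N m : ℕ} (d : ℕ) (P : Fin m → ℙ F (Fin N → F)) :
    MvPolynomial.homogeneousSubmodule (Fin N) F d →ₗ[F] (Fin m → F) where
  toFun G i := MvPolynomial.eval (normRep (P i)) (G : MvPolynomial (Fin N) F)
  map_add' G G' := by ext i; simp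
  map_smul' c G := by ext i; simp [MvPolynomial.smul_eval]

/-- The functional code `C_d(X)`, for an enumeration `e` of the rational points of `X`. -/
def functionalCode {F : Type*} [Field F] {N m : ℕ} (d : ℕ) (X : Set (ℙ F (Fin N → F)))
    (e : Fin m ≃ X) : Submodule F (Fin m → F) :=
  LinearMap.range (evalMap d fun i => (e i : ℙ F (Fin N → F)))

open Classical in
/-- The minimum distance: the least Hamming weight of a nonzero codeword. -/
def minDist {F : Type*} [Field F] {m : ℕ} (C : Submodule F (Fin m → F)) : ℕ :=
  sInf {w | ∃ c ∈ C, c ≠ 0 ∧ w = hammingNorm c}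

end

end HermitianCode

namespace HermitianCode

section FiniteField

theorem range_powMonoidHom_eq_ker_powMonoidHom {G : Type*} [CommGroup G] [Finite G] [IsCyclic G]
    {a b : ℕ} (h : Nat.card G = a * b) :
    (powMonoidHom a : G →* G).range = (powMonoidHom b).ker := by
  have hpos : 0 < a * b := h ▸ Nat.card_pos
  refine Subgroup.eq_of_le_of_card_ge ?_ ?_
  · rintro _ ⟨x, rfl⟩
    rw [MonoidHom.mem_ker, powMonoidHom_apply, powMonoidHom_apply, ← pow_mul, ← h, pow_card_eq_one']
  · rw [IsCyclic.card_powMonoidHom_ker, IsCyclic.card_powMonoidHom_range, h,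
      Nat.gcd_mul_left_left, Nat.gcd_mul_right_left,
      Nat.mul_div_cancel_left _ (Nat.pos_of_mul_pos_right hpos)]

variable {F : Type*} [Field F] [Fintype F] {q : ℕ}

theorem two_le_of_card_eq_sq (hF : Fintype.card F = q ^ 2) : 2 ≤ q := by
  have h : 1 < q ^ 2 := hF ▸ Fintype.one_lt_card
  exact (Nat.one_lt_pow_iff two_ne_zero).1 h

theorem exists_ringHom_eq_pow (hF : Fintype.card F = q ^ 2) :
    ∃ σ : F →+* F, ∀ x, σ x = x ^ q := by
  obtain ⟨p, hp⟩ := CharP.exists F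
  obtain ⟨k, hpp, hk⟩ := FiniteField.card F p
  obtain ⟨l, -, rfl⟩ := (Nat.dvd_prime_pow hpp).1 (hk ▸ hF ▸ dvd_pow_self q two_ne_zero)
  have : ExpChar F p := ExpChar.prime hpp
  exact ⟨iterateFrobenius F p l, iterateFrobenius_def p l⟩

theorem pow_q_pow_q (hF : Fintype.card F = q ^ 2) (x : F) : (x ^ q) ^ q = x := by
  rw [← pow_mul, ← sq, ← hF, FiniteField.pow_card]

theorem card_units_eq_of_card_eq_sq (hF : Fintype.card F = q ^ 2) :
    Nat.card Fˣ = (q + 1) * (q - 1) := by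
  rw [Nat.card_units, Nat.card_eq_fintype_card, hF]
  exact Nat.sq_sub_sq q 1

theorem exists_pow_succ_eq (hF : Fintype.card F = q ^ 2) {c : F} (hc : c ≠ 0) (hcq : c ^ q = c) :
    ∃ x : F, x ^ (q + 1) = c := by
  have hq : 1 ≤ q := (two_le_of_card_eq_sq hF).trans' one_le_two
  have hmem : Units.mk0 c hc ∈ (powMonoidHom (q - 1) : Fˣ →* Fˣ).ker := by
    refine Units.ext (mul_right_cancel₀ hc ?_)
    simpa [← pow_succ, Nat.sub_add_cancel hq] using hcq
  rw [← range_powMonoidHom_eq_ker_powMonoidHom (card_units_eq_of_card_eq_sq hF)] at hmem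
  obtain ⟨x, hx⟩ := hmem
  exact ⟨x, by simpa using congrArg Units.val hx⟩

theorem exists_isPrimitiveRoot_of_dvd_card_units {F : Type*} [Field F] [Finite F] {k : ℕ}
    (hk : k ∣ Nat.card Fˣ) :
    ∃ ζ : F, IsPrimitiveRoot ζ k := by
  obtain ⟨g, hg⟩ := IsCyclic.exists_ofOrder_eq_natCard (α := Fˣ)
  obtain ⟨l, hl⟩ := hk
  have hprim : IsPrimitiveRoot (g : F) (Nat.card Fˣ) := by
    rw [← hg, ← orderOf_units]
    exact IsPrimitiveRoot.orderOf _
  exact ⟨_, hprim.pow Nat.card_pos (by rw [hl, mul_comm])⟩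

theorem card_pow_succ_eq [DecidableEq F] (hF : Fintype.card F = q ^ 2) {c : F} (hc : c ≠ 0)
    (hcq : c ^ q = c) : (Finset.univ.filter fun x : F => x ^ (q + 1) = c).card = q + 1 := by
  obtain ⟨ζ, hζ⟩ := exists_isPrimitiveRoot_of_dvd_card_units
    (Dvd.intro _ (card_units_eq_of_card_eq_sq hF).symm)
  have hfilter : (Finset.univ.filter fun x : F => x ^ (q + 1) = c) =
      (Polynomial.nthRoots (q + 1) c).toFinset := by
    ext x
    simp [Polynomial.mem_nthRoots]
  rw [hfilter, Multiset.toFinset_card_of_nodup (hζ.nthRoots_nodup hc), hζ.card_nthRoots,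
    if_pos (exists_pow_succ_eq hF hc hcq)]

theorem exists_add_pow_ne_zero (hF : Fintype.card F = q ^ 2) : ∃ t : F, t + t ^ q ≠ 0 := by
  have hq := two_le_of_card_eq_sq hF
  have hdeg : (Polynomial.X + Polynomial.X ^ q : Polynomial F).natDegree = q := by
    rw [Polynomial.natDegree_add_eq_right_of_natDegree_lt] <;>
      simp only [Polynomial.natDegree_X, Polynomial.natDegree_X_pow]
    exact hq
  obtain ⟨t, ht⟩ := Polynomial.exists_eval_ne_zero_of_natDegree_lt_card
    (Polynomial.X + Polynomial.X ^ q : Polynomial F) (by rintro h; simp [h] at hdeg; omega)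
    (by rw [hdeg, Cardinal.mk_fintype, hF]; exact_mod_cast by nlinarith)
  exact ⟨t, by simpa using ht⟩

end FiniteField

section SesquilinearForm

variable {F : Type*} [Field F] {σ : F →+* F} {V : Type*} [AddCommGroup V] [Module F V]
  {B : V →ₛₗ[σ] V →ₗ[F] F}

theorem apply_eq_zero_of_forall_mem_isotropic (hσ : ∃ t, t + σ t ≠ 0) (hB : B.IsSymm)
    {W : Submodule F V} (hW : ∀ x ∈ W, B x x = 0) {x y : V} (hx : x ∈ W) (hy : y ∈ W) :
    B x y = 0 := by
  by_contra hxy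
  obtain ⟨t, ht⟩ := hσ
  have hyx : B y x ≠ 0 := mt hB.eq_iff.1 hxy
  have hpolar := hW _ (W.add_mem (W.smul_mem (t * (B y x)⁻¹) hx) hy)
  simp only [map_add, map_smul, LinearMap.add_apply, LinearMap.smul_apply, hW x hx, hW y hy,
    LinearMap.map_smulₛₗ, smul_eq_mul, map_mul, map_inv₀, ← hB.eq y x] at hpolar
  have hσyx : σ (B y x) ≠ 0 := by rwa [hB.eq]
  apply ht
  rw [mul_zero, zero_add, add_zero, mul_assoc, mul_assoc, inv_mul_cancel₀ hσyx,
    inv_mul_cancel₀ hyx, mul_one, mul_one] at hpolar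
  exact hpolar

theorem exists_apply_self_eq_one (hσ : ∀ c ≠ 0, σ c = c → ∃ a, σ a * a = c) (hB : B.IsSymm)
    (h : ∃ x, B x x ≠ 0) : ∃ x, B x x = 1 := by
  obtain ⟨x, hx⟩ := h
  obtain ⟨a, ha⟩ := hσ _ (inv_ne_zero hx) (by rw [map_inv₀, hB.eq])
  refine ⟨a • x, ?_⟩
  rw [map_smul, LinearMap.map_smulₛₗ, LinearMap.smul_apply, smul_eq_mul, smul_eq_mul, ← mul_assoc,
    mul_comm a, ha, inv_mul_cancel₀ hx]

theorem exists_basis_fin_eq_ite (hσ : ∃ t, t + σ t ≠ 0)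
    (hσ' : ∀ c ≠ 0, σ c = c → ∃ a, σ a * a = c) (n : ℕ) :
    ∀ {V : Type*} [AddCommGroup V] [Module F V] [FiniteDimensional F V] {B : V →ₛₗ[σ] V →ₗ[F] F},
      B.IsSymm → Module.finrank F V = n → ∃ r ≤ n, ∃ b : Module.Basis (Fin n) F V,
        ∀ i j, B (b i) (b j) = if i = j ∧ (i : ℕ) < r then 1 else 0 := by
  induction n with
  | zero =>
    intro V _ _ _ _ _ hn
    exact ⟨0, le_rfl, Module.finBasisOfFinrankEq F V hn, fun i => i.elim0⟩
  | succ n ih =>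
    intro V _ _ _ B hB hn
    by_cases hisotropic : ∀ x, B x x = 0
    · refine ⟨0, n.succ.zero_le, Module.finBasisOfFinrankEq F V hn, fun i j => ?_⟩
      simpa using apply_eq_zero_of_forall_mem_isotropic hσ hB (fun x _ => hisotropic x)
        (Submodule.mem_top (R := F)) Submodule.mem_top
    obtain ⟨x, hx⟩ := exists_apply_self_eq_one hσ' hB (not_forall.1 hisotropic)
    set W : Submodule F V := LinearMap.ker (B x)
    have hfinrank : Module.finrank F W = n := by
      have : Module.finrank F W + 1 = Module.finrank F V :=
        Module.Dual.finrank_ker_add_one_of_ne_zero (fun h => by simp [h] at hx)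
      omega
    obtain ⟨r, hr, b, hb⟩ := ih (hB.domRestrict W) hfinrank
    refine ⟨r + 1, by omega, Module.Basis.mkFinCons x b ?_ ?_, ?_⟩
    · intro c z hz hcz
      simpa [hx, LinearMap.mem_ker.1 hz] using congrArg (B x) hcz
    · exact fun z => ⟨-B x z, by simp [W, hx]⟩
    · have horth (i) : B x (b i) = 0 := (b i).2
      intro i j
      cases i using Fin.cases <;> cases j using Fin.cases
      · simp [hx]
      · simp [horth, (Fin.succ_ne_zero _).symm]
      · simp [hB.eq_iff.1 (horth _)]
      · simpa [LinearMap.domRestrict₁₂_apply] using hb _ _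

theorem finrank_ker_of_isOrthoᵢ {ι : Type*} [Finite ι] (hB : B.IsSymm)
    {b : Module.Basis ι F V} (hb : B.IsOrthoᵢ b) :
    Module.finrank F (LinearMap.ker B) = Nat.card {i // B (b i) (b i) = 0} := by
  have := Fintype.ofFinite ι
  have happly (i x) : B (b i) x = b.repr x i * B (b i) (b i) := by
    conv_lhs => rw [← b.sum_repr x]
    rw [map_sum, Finset.sum_eq_single_of_mem i (Finset.mem_univ i), map_smul, smul_eq_mul]
    exact fun j _ hj => by rw [map_smul, LinearMap.isOrthoᵢ_def.1 hb i j hj.symm, smul_zero]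
  have hker : LinearMap.ker B = Submodule.span F (b '' {i | B (b i) (b i) = 0}) := by
    ext x
    rw [b.mem_span_image, LinearMap.mem_ker]
    calc B x = 0 ↔ ∀ i, B x (b i) = 0 := ⟨fun h => by simp [h], fun h => b.ext (by simpa using h)⟩
      _ ↔ ∀ i, b.repr x i * B (b i) (b i) = 0 := forall_congr' fun i => by rw [hB.eq_iff, happly]
      _ ↔ _ := by simp [Set.subset_def, or_iff_not_imp_left]
  have hindep : LinearIndepOn F id (b '' {i | B (b i) (b i) = 0}) :=
    (b.linearIndependent.linearIndepOn _).id_image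
  classical
  rw [hker, finrank_span_set_eq_card hindep, ← Set.ncard_eq_toFinset_card',
    Set.ncard_image_of_injective _ b.injective]
  rfl

theorem exists_isometry [FiniteDimensional F V] {V' : Type*} [AddCommGroup V'] [Module F V']
    [FiniteDimensional F V'] {B' : V' →ₛₗ[σ] V' →ₗ[F] F}
    (hσ : ∃ t, t + σ t ≠ 0) (hσ' : ∀ c ≠ 0, σ c = c → ∃ a, σ a * a = c)
    (hB : B.IsSymm) (hB' : B'.IsSymm) (hV : Module.finrank F V = Module.finrank F V')
    (hker : Module.finrank F (LinearMap.ker B) = Module.finrank F (LinearMap.ker B')) :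
    ∃ φ : V ≃ₗ[F] V', ∀ x y, B' (φ x) (φ y) = B x y := by
  obtain ⟨r, hr, b, hb⟩ := exists_basis_fin_eq_ite hσ hσ' _ hB rfl
  obtain ⟨r', hr', b', hb'⟩ := exists_basis_fin_eq_ite hσ hσ' _ hB' hV.symm
  have hcard (k : ℕ) : Nat.card {i : Fin (Module.finrank F V) // ¬ (i : ℕ) < k} =
      Module.finrank F V - k := by
    rw [Nat.card_eq_fintype_card, Fintype.card_subtype_compl, Fintype.card_fin,
      Fintype.card_subtype, Fin.card_filter_val_lt]
    omega
  have hrr' : r = r' := by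
    rw [finrank_ker_of_isOrthoᵢ hB (b := b) fun i j hij => (hb i j).trans (if_neg (by tauto)),
      finrank_ker_of_isOrthoᵢ hB' (b := b') fun i j hij => (hb' i j).trans (if_neg (by tauto))]
      at hker
    simp only [hb, hb', true_and, ite_eq_right_iff, one_ne_zero, imp_false, hcard] at hker
    omega
  subst hrr'
  refine ⟨b.equiv b' (Equiv.refl _), fun x y => ?_⟩
  have hrepr (z) : b'.repr (b.equiv b' (Equiv.refl _) z) = b.repr z := by
    simp [Module.Basis.equiv]
  rw [← LinearMap.sum_repr_mul_repr_mulₛₗ b b x y, ← LinearMap.sum_repr_mul_repr_mulₛₗ b' b']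
  simp only [hrepr, hb, hb']

theorem ker_le_span_singleton (hσ : ∃ t, t + σ t ≠ 0) (hσ' : Function.Involutive σ) (hB : B.IsSymm)
    (hker : LinearMap.ker B = ⊥) {x : V} (hx : ∀ v, B x v = 0 → B v v = 0) :
    LinearMap.ker (B x) ≤ Submodule.span F {x} := by
  intro z hz
  have hle : ⨅ _ : Unit, LinearMap.ker (B x) ≤ LinearMap.ker (B z) := fun v hv =>
    apply_eq_zero_of_forall_mem_isotropic hσ hB hx hz (by simpa using hv)
  have hspan := mem_span_of_iInf_ker_le_ker hle
  rw [Set.range_const, Submodule.mem_span_singleton] at hspan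
  obtain ⟨c, hc⟩ := hspan
  refine Submodule.mem_span_singleton.2 ⟨σ c, LinearMap.ker_eq_bot.1 hker ?_⟩
  rw [LinearMap.map_smulₛₗ, hσ' c, hc]

variable [FiniteDimensional F V]

theorem exists_orthogonal_anisotropic (hσ : ∃ t, t + σ t ≠ 0) (hσ' : Function.Involutive σ)
    (hB : B.IsSymm) (hker : LinearMap.ker B = ⊥) (hV : 3 ≤ Module.finrank F V) {x : V}
    (hx : x ≠ 0) : ∃ v, B x v = 0 ∧ B v v ≠ 0 := by
  by_contra! h
  have hle := (Submodule.finrank_mono (ker_le_span_singleton hσ hσ' hB hker h)).trans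
    (finrank_span_singleton hx).le
  have := Module.Dual.finrank_ker_add_one_of_ne_zero (f := B x)
    (mt (LinearMap.ker_eq_bot'.1 hker x) hx)
  omega

theorem exists_orthogonal_anisotropic_of_apply_self_ne_zero (hσ : ∃ t, t + σ t ≠ 0)
    (hσ' : Function.Involutive σ) (hB : B.IsSymm) (hker : LinearMap.ker B = ⊥)
    (hV : 2 ≤ Module.finrank F V) {x : V} (hx : B x x ≠ 0) : ∃ v, B x v = 0 ∧ B v v ≠ 0 := by
  by_contra! h
  have hbot : LinearMap.ker (B x) = ⊥ := by
    refine (Submodule.eq_bot_iff _).2 fun z hz => ?_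
    obtain ⟨c, rfl⟩ := Submodule.mem_span_singleton.1 (ker_le_span_singleton hσ hσ' hB hker h hz)
    have hc : c = 0 := by simpa [hx] using hz
    rw [hc, zero_smul]
  have := Module.Dual.finrank_ker_add_one_of_ne_zero (f := B x) (fun h => by simp [h] at hx)
  rw [hbot, finrank_bot] at this
  omega

end SesquilinearForm

section MatrixForm

variable {F : Type*} [Field F]

/-- The sesquilinear form `(x, y) ↦ yᵀ H σ(x)`, conjugate-linear in the first argument as Mathlib's
`LinearMap.IsSymm` requires; for `σ = (· ^ q)` its diagonal is the function of
`hermitianForm q H`. -/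
def sesqForm (σ : F →+* F) {ι : Type*} [Fintype ι] [DecidableEq ι] (H : Matrix ι ι F) :
    (ι → F) →ₛₗ[σ] (ι → F) →ₗ[F] F :=
  Matrix.toLinearMapₛₗ₂' F σ (RingHom.id F) H.transpose

theorem sesqForm_apply {σ : F →+* F} {ι : Type*} [Fintype ι] [DecidableEq ι] (H : Matrix ι ι F)
    (x y : ι → F) : sesqForm σ H x y = ∑ i, ∑ j, H i j * y i * σ (x j) := by
  rw [sesqForm, Matrix.toLinearMapₛₗ₂'_apply, Finset.sum_comm]
  refine Finset.sum_congr rfl fun i _ => Finset.sum_congr rfl fun j _ => ?_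
  simp only [RingHom.id_apply, smul_eq_mul, Matrix.transpose_apply]
  ring

theorem finrank_ker_sesqForm_add_rank {σ : F →+* F} {ι : Type*} [Fintype ι] [DecidableEq ι]
    {H : Matrix ι ι F} (hH : (sesqForm σ H).IsSymm) :
    Module.finrank F (LinearMap.ker (sesqForm σ H)) + H.rank = Fintype.card ι := by
  have hker : LinearMap.ker (sesqForm σ H) = LinearMap.ker H.transpose.mulVecLin := by
    ext x
    have hsingle (j) : sesqForm σ H (Pi.single j 1) x = (H.transpose.mulVec x) j := by
      simp [sesqForm_apply, Matrix.mulVec, dotProduct, Pi.single_apply, apply_ite σ]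
    calc sesqForm σ H x = 0 ↔ ∀ j, sesqForm σ H x (Pi.single j 1) = 0 :=
          ⟨fun h => by simp [h], fun h => (Pi.basisFun F ι).ext (by simpa using h)⟩
      _ ↔ ∀ j, sesqForm σ H (Pi.single j 1) x = 0 := forall_congr' fun j => hH.eq_iff
      _ ↔ H.transpose.mulVec x = 0 := by simp only [hsingle, funext_iff, Pi.zero_apply]
  rw [hker, ← Matrix.rank_transpose, Matrix.rank, add_comm,
    LinearMap.finrank_range_add_finrank_ker, Module.finrank_fintype_fun_eq_card]

theorem ker_sesqForm_eq_bot {σ : F →+* F} {ι : Type*} [Fintype ι] [DecidableEq ι]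
    {H : Matrix ι ι F} (hH : (sesqForm σ H).IsSymm) (hrank : H.rank = Fintype.card ι) :
    LinearMap.ker (sesqForm σ H) = ⊥ := by
  have := finrank_ker_sesqForm_add_rank hH
  exact Submodule.finrank_eq_zero.1 (by omega)

variable {q N : ℕ} {H : Matrix (Fin N) (Fin N) F}

theorem eval_hermitianForm {σ : F →+* F} (hσ : ∀ x, σ x = x ^ q) (x : Fin N → F) :
    MvPolynomial.eval x (hermitianForm q H) = sesqForm σ H x x := by
  simp [hermitianForm, sesqForm_apply, hσ]

theorem isHomogeneous_hermitianForm : (hermitianForm q H).IsHomogeneous (q + 1) := by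
  refine MvPolynomial.IsHomogeneous.sum _ _ _ fun i _ =>
    MvPolynomial.IsHomogeneous.sum _ _ _ fun j _ => ?_
  rw [show q + 1 = 0 + 1 + 1 * q by ring]
  exact ((MvPolynomial.isHomogeneous_C _ _).mul (MvPolynomial.isHomogeneous_X _ _)).mul
    ((MvPolynomial.isHomogeneous_X _ _).pow q)

theorem IsHermitianMatrix.isSymm_sesqForm {σ : F →+* F} (hσ : ∀ x, σ x = x ^ q)
    (hσ' : Function.Involutive σ) (hH : IsHermitianMatrix q H) : (sesqForm σ H).IsSymm := by
  refine ⟨fun x y => ?_⟩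
  rw [sesqForm_apply, sesqForm_apply, Finset.sum_comm]
  simp only [map_sum, map_mul, hσ' _]
  refine Finset.sum_congr rfl fun i _ => Finset.sum_congr rfl fun j _ => ?_
  rw [hH.2 i j, ← hσ]
  ring

theorem finrank_ker_comp_funLeft_succ {σ : F →+* F} {n : ℕ}
    {B : (Fin n → F) →ₛₗ[σ] (Fin n → F) →ₗ[F] F} (hB : LinearMap.ker B = ⊥) :
    Module.finrank F (LinearMap.ker ((B.comp (LinearMap.funLeft F F Fin.succ)).compl₂
      (LinearMap.funLeft F F Fin.succ))) = 1 := by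
  set l : (Fin (n + 1) → F) →ₗ[F] (Fin n → F) := LinearMap.funLeft F F Fin.succ
  have hl : Function.Surjective l :=
    LinearMap.funLeft_surjective_of_injective F F _ (Fin.succ_injective n)
  have hker : LinearMap.ker ((B.comp l).compl₂ l) = LinearMap.ker l := by
    ext x
    refine ⟨fun h => LinearMap.ker_eq_bot'.1 hB _ (LinearMap.ext (hl.forall.2 fun y => ?_)),
      fun h => LinearMap.ext fun y => ?_⟩
    · exact LinearMap.congr_fun (LinearMap.mem_ker.1 h) y
    · simp [LinearMap.mem_ker.1 h]
  have := l.finrank_range_add_finrank_ker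
  rw [LinearMap.range_eq_top.2 hl, finrank_top, Module.finrank_fin_fun,
    Module.finrank_fin_fun] at this
  rw [hker]
  omega

theorem exists_linearEquiv_eval_hermitianForm_eq_tail [Fintype F] {n : ℕ}
    (hF : Fintype.card F = q ^ 2) {H : Matrix (Fin (n + 1)) (Fin (n + 1)) F}
    (hH : IsHermitianMatrix q H) (hrank : H.rank = n) {H' : Matrix (Fin n) (Fin n) F}
    (hH' : IsHermitianMatrix q H') (hrank' : H'.rank = n) :
    ∃ φ : (Fin (n + 1) → F) ≃ₗ[F] (Fin (n + 1) → F), ∀ x,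
      MvPolynomial.eval (φ x) (hermitianForm q H) =
        MvPolynomial.eval (Fin.tail x) (hermitianForm q H') := by
  obtain ⟨σ, hσ⟩ := exists_ringHom_eq_pow hF
  have hσ' : Function.Involutive σ := fun x => by rw [hσ, hσ, pow_q_pow_q hF]
  have hB := hH.isSymm_sesqForm hσ hσ'
  have hB' := hH'.isSymm_sesqForm hσ hσ'
  have hker := finrank_ker_sesqForm_add_rank hB
  have hker' := ker_sesqForm_eq_bot hB' (by simpa using hrank')
  rw [hrank, Fintype.card_fin] at hker
  obtain ⟨φ, hφ⟩ := exists_isometry (σ := σ)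
    (B := ((sesqForm σ H').comp (LinearMap.funLeft F F Fin.succ)).compl₂
      (LinearMap.funLeft F F Fin.succ)) (B' := sesqForm σ H)
    (by simpa only [hσ] using exists_add_pow_ne_zero hF)
    (fun c hc hcσ => by
      simpa only [hσ, ← pow_succ] using exists_pow_succ_eq hF hc ((hσ c).symm.trans hcσ))
    ⟨fun x y => hB'.eq _ _⟩ hB rfl
    (by rw [finrank_ker_comp_funLeft_succ hker']; omega)
  exact ⟨φ, fun x => by rw [eval_hermitianForm hσ, eval_hermitianForm hσ, hφ]; rfl⟩

end MatrixForm

section Footprint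

open scoped MonomialOrder

variable {F ι : Type*} [Field F]

theorem linearIndependent_eval :
    LinearIndependent F fun (z : ι → F) (f : MvPolynomial ι F) => MvPolynomial.eval z f := by
  let evalHom (z : ι → F) : MvPolynomial ι F →* F := (MvPolynomial.eval z).toMonoidHom
  have hinj : Function.Injective evalHom := fun z w h =>
    funext fun i => by simpa [evalHom] using DFunLike.congr_fun h (MvPolynomial.X i)
  exact (linearIndependent_monoidHom (MvPolynomial ι F) F).comp evalHom hinj

theorem exists_eval_eq_of_degree_eq_single {m : MonomialOrder ι} {b : ι → MvPolynomial ι F}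
    {e : ι → ℕ} (hb : ∀ i, b i ≠ 0) (he : ∀ i, m.degree (b i) = Finsupp.single i (e i))
    (f : MvPolynomial ι F) :
    ∃ r : MvPolynomial ι F, (∀ s ∈ r.support, ∀ i, s i < e i) ∧
      ∀ z, (∀ i, MvPolynomial.eval z (b i) = 0) →
        MvPolynomial.eval z f = MvPolynomial.eval z r := by
  obtain ⟨g, r, hfr, -, hr⟩ :=
    m.div (fun i => (m.leadingCoeff_ne_zero_iff.2 (hb i)).isUnit) f
  refine ⟨r, fun s hs i => ?_, fun z hz => ?_⟩
  · simpa [he] using hr s hs i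
  · simp [hfr, Finsupp.linearCombination_apply, Finsupp.sum, hz]

/-- The monomials outside the ideal of leading terms span all functions on the common zeros. -/
theorem card_le_prod_of_degree_eq_single [Fintype ι] {m : MonomialOrder ι}
    {b : ι → MvPolynomial ι F} {e : ι → ℕ} (hb : ∀ i, b i ≠ 0)
    (he : ∀ i, m.degree (b i) = Finsupp.single i (e i)) {Z : Finset (ι → F)}
    (hZ : ∀ z ∈ Z, ∀ i, MvPolynomial.eval z (b i) = 0) : Z.card ≤ ∏ i, e i := by
  classical
  let v (z : Z) (s : ∀ i, Fin (e i)) : F := ∏ i, (z : ι → F) i ^ (s i : ℕ)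
  suffices hv : LinearIndependent F v by
    simpa only [Module.finrank_fintype_fun_eq_card, Fintype.card_pi, Fintype.card_fin,
      Fintype.card_coe] using hv.fintype_card_le_finrank
  refine Fintype.linearIndependent_iff.2 fun c hc => ?_
  have hmonomial (s : ι →₀ ℕ) (hs : ∀ i, s i < e i) :
      ∑ z : Z, c z * ∏ i, (z : ι → F) i ^ s i = 0 := by
    simpa [v] using congrFun hc fun i => ⟨s i, hs i⟩
  have heval := linearIndependent_eval.comp (fun z : Z => (z : ι → F)) Subtype.val_injective
  refine Fintype.linearIndependent_iff.1 heval c (funext fun f => ?_)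
  obtain ⟨r, hr, hfr⟩ := exists_eval_eq_of_degree_eq_single hb he f
  rw [Finset.sum_apply]
  calc ∑ z : Z, c z * MvPolynomial.eval (z : ι → F) f
      = ∑ z : Z, c z * MvPolynomial.eval (z : ι → F) r :=
        Finset.sum_congr rfl fun z _ => by rw [hfr z (hZ z z.2)]
    _ = ∑ s ∈ r.support, r.coeff s * ∑ z : Z, c z * ∏ i, (z : ι → F) i ^ s i := by
        simp only [MvPolynomial.eval_eq', Finset.mul_sum]
        rw [Finset.sum_comm]
        simp only [mul_left_comm]
    _ = 0 := Finset.sum_eq_zero fun s hs => by rw [hmonomial s (hr s hs), mul_zero]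

end Footprint

section Substitution

open scoped MonomialOrder

variable {R ι κ : Type*} [CommSemiring R]

theorem degree_pow_le_and_coeff_pow {m : MonomialOrder κ} {δ : κ →₀ ℕ} {f : MvPolynomial κ R}
    (hf : m.degree f ≼[m] δ) (k : ℕ) :
    (m.degree (f ^ k) ≼[m] k • δ) ∧ (f ^ k).coeff (k • δ) = f.coeff δ ^ k := by
  induction k with
  | zero => simp
  | succ k ih =>
    rw [pow_succ, pow_succ, add_smul, one_smul, m.coeff_mul_of_add_of_degree_le ih.1 hf, ih.2,
      map_add]
    exact ⟨m.degree_mul_le.trans (by rw [map_add]; exact add_le_add ih.1 hf), rfl⟩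

theorem degree_prod_pow_le_and_coeff_prod_pow {m : MonomialOrder κ} {δ : κ →₀ ℕ}
    {L : ι → MvPolynomial κ R} (hL : ∀ i, m.degree (L i) ≼[m] δ) (s : ι →₀ ℕ) :
    (m.degree (s.prod fun i k => L i ^ k) ≼[m] s.degree • δ) ∧
      (s.prod fun i k => L i ^ k).coeff (s.degree • δ) = s.prod fun i k => (L i).coeff δ ^ k := by
  classical
  induction s using Finsupp.induction_linear with
  | zero => simp
  | single i k => simpa using degree_pow_le_and_coeff_pow (hL i) k
  | add s t hs ht =>
    rw [Finsupp.prod_add_index' (by simp) (by simp [pow_add]),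
      Finsupp.prod_add_index' (by simp) (by simp [pow_add]), map_add, add_smul,
      m.coeff_mul_of_add_of_degree_le hs.1 ht.1, hs.2, ht.2, map_add]
    exact ⟨m.degree_mul_le.trans (by rw [map_add]; exact add_le_add hs.1 ht.1), rfl⟩

theorem degree_eq_of_mem_support {g : MvPolynomial ι R} {e : ℕ} (hg : g.IsHomogeneous e)
    {s : ι →₀ ℕ} (hs : s ∈ g.support) : s.degree = e := by
  rw [Finsupp.degree_eq_weight_one, ← hg (MvPolynomial.mem_support_iff.1 hs)]
  rfl

theorem degree_aeval_le {m : MonomialOrder κ} {δ : κ →₀ ℕ} {L : ι → MvPolynomial κ R}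
    (hL : ∀ i, m.degree (L i) ≼[m] δ) {g : MvPolynomial ι R} {e : ℕ} (hg : g.IsHomogeneous e) :
    m.degree (MvPolynomial.aeval L g) ≼[m] e • δ := by
  rw [MvPolynomial.aeval_def, MvPolynomial.eval₂_eq]
  refine m.degree_sum_le.trans (Finset.sup_le fun s hs => ?_)
  rw [MvPolynomial.algebraMap_eq, ← MvPolynomial.smul_eq_C_mul, ← degree_eq_of_mem_support hg hs]
  exact m.degree_smul_le.trans (degree_prod_pow_le_and_coeff_prod_pow hL s).1

theorem coeff_aeval {m : MonomialOrder κ} {δ : κ →₀ ℕ} {L : ι → MvPolynomial κ R}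
    (hL : ∀ i, m.degree (L i) ≼[m] δ) {g : MvPolynomial ι R} {e : ℕ} (hg : g.IsHomogeneous e) :
    (MvPolynomial.aeval L g).coeff (e • δ) = MvPolynomial.eval (fun i => (L i).coeff δ) g := by
  rw [MvPolynomial.aeval_def, MvPolynomial.eval₂_eq, MvPolynomial.coeff_sum, MvPolynomial.eval_eq]
  refine Finset.sum_congr rfl fun s hs => ?_
  rw [MvPolynomial.algebraMap_eq, MvPolynomial.coeff_C_mul, ← degree_eq_of_mem_support hg hs]
  exact congrArg _ (degree_prod_pow_le_and_coeff_prod_pow hL s).2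

/-- The restriction of `g` to the affine subspace through `w` spanned by the vectors `b a`, as a
polynomial in the coordinates with respect to the `b a`. -/
noncomputable def affineSubst [Fintype κ] (w : ι → R) (b : κ → ι → R) (g : MvPolynomial ι R) :
    MvPolynomial κ R :=
  MvPolynomial.aeval
    (fun i => MvPolynomial.C (w i) + ∑ a, MvPolynomial.C (b a i) * MvPolynomial.X a) g

theorem eval_affineSubst [Fintype κ] (w : ι → R) (b : κ → ι → R) (g : MvPolynomial ι R)
    (z : κ → R) :
    MvPolynomial.eval z (affineSubst w b g) = MvPolynomial.eval (w + ∑ a, z a • b a) g := by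
  rw [affineSubst, ← MvPolynomial.aeval_eq_eval, MvPolynomial.aeval_eq_bind₁,
    MvPolynomial.aeval_bind₁, MvPolynomial.aeval_eq_eval]
  congr 2
  ext i
  simp [mul_comm]

theorem isHomogeneous_affineSubst_zero [Fintype κ] (b : κ → ι → R) {g : MvPolynomial ι R} {e : ℕ}
    (hg : g.IsHomogeneous e) : (affineSubst 0 b g).IsHomogeneous e := by
  have hlinear (i : ι) : (MvPolynomial.C ((0 : ι → R) i) +
      ∑ a, MvPolynomial.C (b a i) * MvPolynomial.X a).IsHomogeneous 1 := by
    rw [Pi.zero_apply, map_zero, zero_add]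
    exact MvPolynomial.IsHomogeneous.sum _ _ _ fun a _ =>
      (MvPolynomial.isHomogeneous_X R a).C_mul _
  exact one_mul e ▸ hg.aeval _ hlinear

end Substitution

section PlaneSection

open scoped MonomialOrder

variable {F ι : Type*} [Field F] {κ : Type*} [LinearOrder κ]

theorem degLex_degree_affineSubst [Fintype κ] {w : ι → F} {b : κ → ι → F} {a₀ : κ} (ha₀ : IsBot a₀)
    {g : MvPolynomial ι F} {e : ℕ} (hg : g.IsHomogeneous e)
    (hgb : MvPolynomial.eval (b a₀) g ≠ 0) :
    affineSubst w b g ≠ 0 ∧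
      MonomialOrder.degLex.degree (affineSubst w b g) = Finsupp.single a₀ e := by
  have hL (i : ι) : MonomialOrder.degLex.degree (MvPolynomial.C (w i) +
      ∑ a, MvPolynomial.C (b a i) * MvPolynomial.X a) ≼[.degLex] Finsupp.single a₀ 1 := by
    refine MonomialOrder.degree_add_le.trans (sup_le ?_ ?_)
    · rw [MonomialOrder.degree_C, map_zero]
      exact bot_le
    · refine MonomialOrder.degree_sum_le.trans (Finset.sup_le fun a _ => ?_)
      rw [← MvPolynomial.smul_eq_C_mul]
      exact MonomialOrder.degree_smul_le.trans (MonomialOrder.degree_X_le_single.trans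
        (MonomialOrder.degLex_single_le_iff.2 (ha₀ a)))
  have hsmul : e • Finsupp.single a₀ 1 = Finsupp.single a₀ e := by simp
  have hcoeff : (affineSubst w b g).coeff (Finsupp.single a₀ e) ≠ 0 := by
    have hb (i : ι) : (MvPolynomial.C (w i) +
        ∑ a, MvPolynomial.C (b a i) * MvPolynomial.X a).coeff (Finsupp.single a₀ 1) = b a₀ i := by
      simp [MvPolynomial.coeff_C, MvPolynomial.coeff_sum, MvPolynomial.coeff_C_mul,
        MvPolynomial.coeff_X, Finsupp.single_left_inj,
        (Finsupp.single_ne_zero.2 one_ne_zero).symm]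
    rw [← hsmul, affineSubst, coeff_aeval hL hg]
    simpa only [hb] using hgb
  refine ⟨fun h => hcoeff (by rw [h, MvPolynomial.coeff_zero]), ?_⟩
  refine MonomialOrder.degLex.toSyn.injective (le_antisymm ?_
    (MonomialOrder.degLex.le_degree (MvPolynomial.mem_support_iff.2 hcoeff)))
  exact hsmul ▸ degree_aeval_le hL hg

theorem degLex_degree_C_mul_X_pow_add [WellFoundedGT κ] {c : F} (hc : c ≠ 0) (a : κ) {k : ℕ}
    {r : MvPolynomial κ F} (hr : r.totalDegree < k) :
    MvPolynomial.C c * MvPolynomial.X a ^ k + r ≠ 0 ∧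
      MonomialOrder.degLex.degree (MvPolynomial.C c * MvPolynomial.X a ^ k + r) =
        Finsupp.single a k := by
  classical
  have hmonomial : MonomialOrder.degLex.degree (MvPolynomial.C c * MvPolynomial.X a ^ k) =
      Finsupp.single a k := by
    rw [MvPolynomial.C_mul_X_pow_eq_monomial, MonomialOrder.degree_monomial, if_neg hc]
  have hlt : MonomialOrder.degLex.degree r ≺[.degLex]
      MonomialOrder.degLex.degree (MvPolynomial.C c * MvPolynomial.X a ^ k) := by
    rw [MonomialOrder.degLex_lt_iff, Finsupp.DegLex.lt_iff]
    left
    simpa [MvPolynomial.degree_degLexDegree, hmonomial] using hr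
  have hdegree := MonomialOrder.degree_add_of_lt hlt
  rw [hmonomial] at hdegree
  refine ⟨fun h => ?_, hdegree⟩
  rw [h, MonomialOrder.degree_zero, eq_comm, Finsupp.single_eq_zero] at hdegree
  omega

variable {V : Type*} [AddCommGroup V] [Module F V] {σ : F →+* F} {B : V →ₛₗ[σ] V →ₗ[F] F} {q : ℕ}
  {P v : V}

theorem exists_eval_eq_apply_self (hσ : ∀ x, σ x = x ^ q) (hq : 1 ≤ q) (hPP : B P P = 0)
    (hPv : B P v = 0) (hvP : B v P = 0) (w : V) :
    ∃ r : MvPolynomial (Fin 2) F, r.totalDegree < q + 1 ∧ ∀ z : Fin 2 → F,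
      MvPolynomial.eval z (MvPolynomial.C (B v v) * MvPolynomial.X 1 ^ (q + 1) + r) =
        B (w + ∑ a, z a • ![P, v] a) (w + ∑ a, z a • ![P, v] a) := by
  have hmonomial (c : F) (a : Fin 2) {k : ℕ} (hk : k ≤ q) :
      MvPolynomial.C c * MvPolynomial.X a ^ k ∈ MvPolynomial.restrictTotalDegree (Fin 2) F q := by
    rw [MvPolynomial.mem_restrictTotalDegree, MvPolynomial.C_mul_X_pow_eq_monomial]
    exact (MvPolynomial.totalDegree_monomial_le _ _).trans (by simpa using hk)
  refine ⟨MvPolynomial.C (B w w) * MvPolynomial.X 0 ^ 0 +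
    MvPolynomial.C (B w P) * MvPolynomial.X 0 ^ 1 + MvPolynomial.C (B w v) * MvPolynomial.X 1 ^ 1 +
    MvPolynomial.C (B P w) * MvPolynomial.X 0 ^ q + MvPolynomial.C (B v w) * MvPolynomial.X 1 ^ q,
    Nat.lt_succ_of_le ((MvPolynomial.mem_restrictTotalDegree _ _ _).1 ?_), fun z => ?_⟩
  · exact add_mem (add_mem (add_mem (add_mem (hmonomial _ _ q.zero_le) (hmonomial _ _ hq))
      (hmonomial _ _ hq)) (hmonomial _ _ le_rfl)) (hmonomial _ _ le_rfl)
  · simp [Fin.sum_univ_two, hσ, hPP, hPv, hvP]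
    ring

theorem card_plane_section_le {B : (ι → F) →ₛₗ[σ] (ι → F) →ₗ[F] F} {P v : ι → F}
    (hσ : ∀ x, σ x = x ^ q) (hq : 1 ≤ q) (hPP : B P P = 0) (hPv : B P v = 0) (hvP : B v P = 0)
    (hvv : B v v ≠ 0) {g : MvPolynomial ι F} {e : ℕ} (hg : g.IsHomogeneous e)
    (hgP : MvPolynomial.eval P g ≠ 0) (w : ι → F) {Z : Finset (Fin 2 → F)}
    (hZB : ∀ z ∈ Z, B (w + ∑ a, z a • ![P, v] a) (w + ∑ a, z a • ![P, v] a) = 0)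
    (hZg : ∀ z ∈ Z, MvPolynomial.eval (w + ∑ a, z a • ![P, v] a) g = 0) :
    Z.card ≤ e * (q + 1) := by
  obtain ⟨r, hr, heval⟩ := exists_eval_eq_apply_self hσ hq hPP hPv hvP w
  obtain ⟨hg0, hgdeg⟩ := degLex_degree_affineSubst (w := w) (b := ![P, v]) (a₀ := 0)
    (fun a => Fin.zero_le a) hg hgP
  obtain ⟨hB0, hBdeg⟩ := degLex_degree_C_mul_X_pow_add hvv (1 : Fin 2) hr
  have h := card_le_prod_of_degree_eq_single (m := .degLex) (Z := Z) (e := ![e, q + 1])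
    (b := ![affineSubst w ![P, v] g, MvPolynomial.C (B v v) * MvPolynomial.X 1 ^ (q + 1) + r])
    (Fin.forall_fin_two.2 ⟨hg0, hB0⟩) (Fin.forall_fin_two.2 ⟨hgdeg, hBdeg⟩)
    fun z hz => Fin.forall_fin_two.2
      ⟨(eval_affineSubst w _ g z).trans (hZg z hz), (heval z).trans (hZB z hz)⟩
  rwa [Fin.prod_univ_two] at h

end PlaneSection

section IsotropicVectors

theorem eval_smul_of_isHomogeneous {R ι : Type*} [CommSemiring R] {g : MvPolynomial ι R} {e : ℕ}
    (hg : g.IsHomogeneous e) (c : R) (x : ι → R) :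
    MvPolynomial.eval (c • x) g = c ^ e * MvPolynomial.eval x g := by
  rw [MvPolynomial.eval_eq, MvPolynomial.eval_eq, Finset.mul_sum]
  refine Finset.sum_congr rfl fun s hs => ?_
  simp only [Pi.smul_apply, smul_eq_mul, mul_pow, Finset.prod_mul_distrib,
    Finset.prod_pow_eq_pow_sum, ← degree_eq_of_mem_support hg hs, Finsupp.degree_apply]
  ring

theorem eval_eq_zero_of_eval_line_eq_zero {R ι : Type*} [CommRing R] [IsDomain R]
    {g : MvPolynomial ι R} {x v : ι → R} {S : Finset R} (hS : g.totalDegree < S.card)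
    (h : ∀ t ∈ S, MvPolynomial.eval (x + t • v) g = 0) : MvPolynomial.eval x g = 0 := by
  let p : Polynomial R :=
    MvPolynomial.aeval (fun i => Polynomial.C (x i) + Polynomial.C (v i) * Polynomial.X) g
  have hp (t : R) : p.eval t = MvPolynomial.eval (x + t • v) g := by
    rw [← Polynomial.coe_aeval_eq_eval]
    refine (MvPolynomial.comp_aeval_apply _ (Polynomial.aeval t) g).trans ?_
    rw [MvPolynomial.aeval_eq_eval]
    congr 2
    ext i
    simp only [map_add, map_mul, Polynomial.aeval_C, Polynomial.aeval_X, Algebra.algebraMap_self,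
      RingHom.id_apply, Pi.add_apply, Pi.smul_apply, smul_eq_mul, mul_comm]
  have hdegree : p.natDegree ≤ g.totalDegree * 1 :=
    MvPolynomial.aeval_natDegree_le g le_rfl _ fun i => by compute_degree
  have hp0 : p = 0 := Polynomial.eq_zero_of_natDegree_lt_card_of_eval_eq_zero' p S
    (fun t ht => (hp t).trans (h t ht)) (by omega)
  simpa [hp0] using (hp 0).symm

variable {F ι : Type*} [Field F] [Fintype F] [Fintype ι] {q : ℕ} {σ : F →+* F}
  {B : (ι → F) →ₛₗ[σ] (ι → F) →ₗ[F] F}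

/-- An anisotropic `x` lies on an affine line with `q + 1` isotropic vectors: choose an anisotropic
`v` orthogonal to `x`, and solve `t ^ (q + 1) = -B x x / B v v`. -/
theorem eval_eq_zero_of_eval_isotropic_eq_zero (hF : Fintype.card F = q ^ 2)
    (hσ : ∀ x, σ x = x ^ q) (hB : B.IsSymm) (hker : LinearMap.ker B = ⊥) (hι : 2 ≤ Fintype.card ι)
    {g : MvPolynomial ι F} (hg : g.totalDegree ≤ q)
    (h : ∀ x, x ≠ 0 → B x x = 0 → MvPolynomial.eval x g = 0) {x : ι → F} (hx : x ≠ 0) :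
    MvPolynomial.eval x g = 0 := by
  classical
  by_cases hxx : B x x = 0
  · exact h x hx hxx
  have hσ' : Function.Involutive σ := fun x => by rw [hσ, hσ, pow_q_pow_q hF]
  obtain ⟨v, hxv, hvv⟩ := exists_orthogonal_anisotropic_of_apply_self_ne_zero
    (by simpa only [hσ] using exists_add_pow_ne_zero hF) hσ' hB hker (by simpa using hι) hxx
  have hvx : B v x = 0 := by rw [← hB.eq x v, hxv, map_zero]
  set c := -(B x x) / B v v with hc
  have hcq : c ^ q = c := by rw [← hσ, hc, map_div₀, map_neg, hB.eq, hB.eq]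
  refine eval_eq_zero_of_eval_line_eq_zero (v := v)
    (S := Finset.univ.filter fun t : F => t ^ (q + 1) = c) ?_ fun t ht => h _ (fun h0 => hxx ?_) ?_
  · rw [card_pow_succ_eq hF (div_ne_zero (neg_ne_zero.2 hxx) hvv) hcq]
    omega
  · simpa [hxv] using congrArg (B x) h0
  · have htc : t ^ (q + 1) * B v v = -B x x := by
      rw [(Finset.mem_filter.1 ht).2, hc, div_mul_cancel₀ _ hvv]
    simp only [map_add, map_smul, LinearMap.add_apply, LinearMap.smul_apply, smul_eq_mul,
      LinearMap.map_smulₛₗ, hvx, hxv, hσ]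
    linear_combination htc

theorem exists_isotropic_eval_ne_zero (hF : Fintype.card F = q ^ 2)
    (hσ : ∀ x, σ x = x ^ q) (hB : B.IsSymm) (hker : LinearMap.ker B = ⊥) (hι : 2 ≤ Fintype.card ι)
    {g : MvPolynomial ι F} {e : ℕ} (hg : g.IsHomogeneous e) (he : e ≤ q) (hg0 : g ≠ 0) :
    ∃ x, x ≠ 0 ∧ B x x = 0 ∧ MvPolynomial.eval x g ≠ 0 := by
  classical
  by_contra! h
  have heval {x : ι → F} (hx : x ≠ 0) : MvPolynomial.eval x g = 0 :=
    eval_eq_zero_of_eval_isotropic_eq_zero hF hσ hB hker hι (hg.totalDegree_le.trans he) h hx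
  obtain ⟨i⟩ : Nonempty ι := Fintype.card_pos_iff.1 (by omega)
  refine hg0 (hg.eq_zero_of_forall_eval_eq_zero_of_le_card (fun x => ?_) ?_)
  · rcases eq_or_ne x 0 with rfl | hx
    · simpa [heval (x := Pi.single i 1) (by simp)] using
        eval_smul_of_isHomogeneous hg 0 (Pi.single i 1)
    · exact heval hx
  · rw [Cardinal.mk_fintype, hF]
    exact_mod_cast he.trans (Nat.le_self_pow two_ne_zero q)

end IsotropicVectors

section Sections

theorem card_le_mul_of_card_cosets_le {F V : Type*} [Field F] [Fintype F] [AddCommGroup V]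
    [Module F V] [Finite V] {K : Submodule F V} {S : Finset V} (hS : ∀ x ∈ S, x ∉ K) {c : ℕ}
    (hc : ∀ w, ∀ T ⊆ S, (∀ x ∈ T, x - w ∈ K) → T.card ≤ c) :
    S.card ≤ c * (Fintype.card F ^ (Module.finrank F V - Module.finrank F K) - 1) := by
  classical
  have : Fintype (V ⧸ K) := @Fintype.ofFinite _ (Finite.of_surjective K.mkQ K.mkQ_surjective)
  have hcard : (Finset.univ.erase (0 : V ⧸ K)).card =
      Fintype.card F ^ (Module.finrank F V - Module.finrank F K) - 1 := by
    rw [Finset.card_erase_of_mem (Finset.mem_univ _), Finset.card_univ,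
      Module.card_eq_pow_finrank (K := F), K.finrank_quotient]
  rw [← hcard]
  refine Finset.card_le_mul_card_image_of_maps_to (f := K.mkQ) (fun x hx => ?_) c fun b _ => ?_
  · simpa using hS x hx
  · obtain ⟨w, rfl⟩ := K.mkQ_surjective b
    refine hc w _ (Finset.filter_subset _ _) fun x hx => ?_
    exact (Submodule.Quotient.eq K).1 (Finset.mem_filter.1 hx).2

variable {F ι : Type*} [Field F] {σ : F →+* F} {B : (ι → F) →ₛₗ[σ] (ι → F) →ₗ[F] F} {P v : ι → F}

theorem linearIndependent_pair_of_apply_eq_zero (hP : P ≠ 0) (hvP : B v P = 0)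
    (hvv : B v v ≠ 0) : LinearIndependent F ![P, v] := by
  refine LinearIndependent.pair_iff.2 fun s t hst => ?_
  have ht : t = 0 := by simpa [hvP, hvv] using congrArg (B v) hst
  subst ht
  simpa [hP] using hst

theorem eq_zero_of_mem_span_of_isotropic (hPP : B P P = 0) (hPv : B P v = 0) (hvP : B v P = 0)
    (hvv : B v v ≠ 0) {g : MvPolynomial ι F} {e : ℕ} (hg : g.IsHomogeneous e)
    (hgP : MvPolynomial.eval P g ≠ 0) {x : ι → F} (hx : x ∈ Submodule.span F (Set.range ![P, v]))
    (hxx : B x x = 0) (hgx : MvPolynomial.eval x g = 0) : x = 0 := by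
  obtain ⟨z, rfl⟩ := (Submodule.mem_span_range_iff_exists_fun F).1 hx
  have hz1 : z 1 = 0 := by
    simpa [Fin.sum_univ_two, hPP, hPv, hvP, hvv, LinearMap.map_smulₛₗ] using hxx
  simp only [Fin.sum_univ_two, Matrix.cons_val_zero, Matrix.cons_val_one, hz1, zero_smul,
    add_zero] at hgx ⊢
  rw [eval_smul_of_isHomogeneous hg, mul_eq_zero, or_iff_left hgP] at hgx
  rw [eq_zero_of_pow_eq_zero hgx, zero_smul]

variable {q : ℕ}

theorem card_coset_section_le [Finite F] (hσ : ∀ x, σ x = x ^ q) (hq : 1 ≤ q) (hPP : B P P = 0)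
    (hPv : B P v = 0) (hvP : B v P = 0) (hvv : B v v ≠ 0) {g : MvPolynomial ι F} {e : ℕ}
    (hg : g.IsHomogeneous e) (hgP : MvPolynomial.eval P g ≠ 0) {w : ι → F} {T : Finset (ι → F)}
    (hTw : ∀ x ∈ T, x - w ∈ Submodule.span F (Set.range ![P, v])) (hTB : ∀ x ∈ T, B x x = 0)
    (hTg : ∀ x ∈ T, MvPolynomial.eval x g = 0) : T.card ≤ e * (q + 1) := by
  classical
  have := Fintype.ofFinite F
  let Z : Finset (Fin 2 → F) := Finset.univ.filter fun z => w + ∑ a, z a • ![P, v] a ∈ T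
  have hZ (z) (hz : z ∈ Z) : w + ∑ a, z a • ![P, v] a ∈ T := (Finset.mem_filter.1 hz).2
  have hsub : T ⊆ Z.image fun z => w + ∑ a, z a • ![P, v] a := fun x hx => by
    obtain ⟨z, hz⟩ := (Submodule.mem_span_range_iff_exists_fun F).1 (hTw x hx)
    have hzx : w + ∑ a, z a • ![P, v] a = x := by rw [hz, add_sub_cancel]
    exact Finset.mem_image.2 ⟨z, Finset.mem_filter.2 ⟨Finset.mem_univ z, hzx ▸ hx⟩, hzx⟩
  exact (Finset.card_le_card hsub).trans (Finset.card_image_le.trans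
    (card_plane_section_le hσ hq hPP hPv hvP hvv hg hgP w (fun z hz => hTB _ (hZ z hz))
      fun z hz => hTg _ (hZ z hz)))

variable [Fintype F] [Fintype ι] [DecidableEq F] [DecidableEq ι]

/-- Cut the variety by the cosets of a plane spanned by an isotropic vector outside `V(g)` and an
anisotropic vector orthogonal to it: the plane itself contributes only the origin. -/
theorem card_isotropic_section_le (hF : Fintype.card F = q ^ 2)
    (hσ : ∀ x, σ x = x ^ q) (hB : B.IsSymm) (hker : LinearMap.ker B = ⊥)
    (hι : 3 ≤ Fintype.card ι) {g : MvPolynomial ι F} {e : ℕ} (hg : g.IsHomogeneous e)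
    (he : e ≤ q) (hg0 : g ≠ 0) :
    (Finset.univ.filter fun x => x ≠ 0 ∧ B x x = 0 ∧ MvPolynomial.eval x g = 0).card ≤
      e * (q + 1) * ((q ^ 2) ^ (Fintype.card ι - 2) - 1) := by
  have hσ' : Function.Involutive σ := fun x => by rw [hσ, hσ, pow_q_pow_q hF]
  obtain ⟨P, hP, hPP, hgP⟩ := exists_isotropic_eval_ne_zero hF hσ hB hker (by omega) hg he hg0
  obtain ⟨v, hPv, hvv⟩ := exists_orthogonal_anisotropic
    (by simpa only [hσ] using exists_add_pow_ne_zero hF) hσ' hB hker (by simpa using hι) hP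
  have hvP : B v P = 0 := by rw [← hB.eq P v, hPv, map_zero]
  have hfinrank := finrank_span_eq_card (linearIndependent_pair_of_apply_eq_zero hP hvP hvv)
  have h := card_le_mul_of_card_cosets_le (K := Submodule.span F (Set.range ![P, v]))
    (S := Finset.univ.filter fun x => x ≠ 0 ∧ B x x = 0 ∧ MvPolynomial.eval x g = 0)
    (c := e * (q + 1)) (fun x hx hxK => ?_) fun w T hTS hTw => ?_
  · rwa [hfinrank, Module.finrank_fintype_fun_eq_card, hF, Fintype.card_fin] at h
  · obtain ⟨-, hx0, hxx, hgx⟩ := Finset.mem_filter.1 hx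
    exact hx0 (eq_zero_of_mem_span_of_isotropic hPP hPv hvP hvv hg hgP hxK hxx hgx)
  · have hmem (x) (hx : x ∈ T) := (Finset.mem_filter.1 (hTS hx)).2.2
    exact card_coset_section_le hσ (one_le_two.trans (two_le_of_card_eq_sq hF)) hPP hPv hvP hvv hg
      hgP hTw (fun x hx => (hmem x hx).1) fun x hx => (hmem x hx).2

end Sections

section Points

variable {F : Type*} [Field F]

theorem card_mul_card_units {V : Type*} [AddCommGroup V] [Module F V] (S : Set (ℙ F V)) :
    Nat.card S * Nat.card Fˣ =
      Nat.card {v : V // ∃ hv : v ≠ 0, Projectivization.mk F v hv ∈ S} := by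
  rw [← Nat.card_prod]
  have hmk (P : ℙ F V) (u : Fˣ) (hu : (u • P.rep : V) ≠ 0) :
      Projectivization.mk F (u • P.rep : V) hu = P := by
    conv_rhs => rw [← P.mk_rep]
    exact (Projectivization.mk_eq_mk_iff F _ _ _ _).2 ⟨u, rfl⟩
  have hne (P : ℙ F V) (u : Fˣ) : (u • P.rep : V) ≠ 0 := (smul_ne_zero_iff_ne u).2 P.rep_nonzero
  refine Nat.card_congr (Equiv.ofBijective
    (fun x => ⟨x.2 • (x.1 : ℙ F V).rep, hne _ _, (hmk _ _ _).symm ▸ x.1.2⟩) ⟨?_, ?_⟩)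
  · rintro ⟨P, u⟩ ⟨P', u'⟩ h
    have hv : u • (P : ℙ F V).rep = u' • (P' : ℙ F V).rep := congrArg Subtype.val h
    obtain rfl : P = P' := Subtype.ext <| by
      rw [← hmk P u (hne _ _), ← hmk P' u' (hne _ _)]
      simp only [hv]
    exact Prod.ext rfl (Units.ext (smul_left_injective F (Projectivization.rep_nonzero P.1) hv))
  · rintro ⟨v, hv, hvS⟩
    obtain ⟨u, hu⟩ := Projectivization.exists_smul_eq_mk_rep F v hv
    exact ⟨⟨⟨_, hvS⟩, u⁻¹⟩, Subtype.ext (inv_smul_eq_iff.2 hu.symm)⟩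

variable {N : ℕ}

theorem mk_mem_zeros_iff {G : MvPolynomial (Fin N) F} {d : ℕ} (hG : G.IsHomogeneous d)
    {v : Fin N → F} (hv : v ≠ 0) :
    Projectivization.mk F v hv ∈ zeros G ↔ MvPolynomial.eval v G = 0 := by
  obtain ⟨u, hu⟩ := (Projectivization.mk_eq_mk_iff F _ _ _ _).1
    (mk_normRep (Projectivization.mk F v hv))
  rw [zeros, Set.mem_ofPred_eq, ← hu, Units.smul_def, eval_smul_of_isHomogeneous hG,
    mul_eq_zero, or_iff_right (pow_ne_zero d u.ne_zero)]

theorem card_zeros_inter_zeros_mul [Fintype F] [DecidableEq F] {f G : MvPolynomial (Fin N) F}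
    {k d : ℕ} (hf : f.IsHomogeneous k) (hG : G.IsHomogeneous d) :
    Nat.card ↥(zeros f ∩ zeros G) * (Fintype.card F - 1) =
      (Finset.univ.filter fun v => v ≠ 0 ∧ MvPolynomial.eval v f = 0 ∧
        MvPolynomial.eval v G = 0).card := by
  rw [← Fintype.card_units, ← Nat.card_eq_fintype_card, card_mul_card_units,
    ← Fintype.card_subtype, ← Nat.card_eq_fintype_card]
  refine Nat.card_congr (Equiv.subtypeEquivRight fun v => ?_)
  rw [← exists_prop]
  exact exists_congr fun hv => and_congr (mk_mem_zeros_iff hf hv) (mk_mem_zeros_iff hG hv)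

theorem zeros_zero : zeros (0 : MvPolynomial (Fin N) F) = Set.univ := by
  simp only [zeros, map_zero, Set.ofPred_true]

theorem card_zeros_mul [Fintype F] [DecidableEq F] {f : MvPolynomial (Fin N) F} {k : ℕ}
    (hf : f.IsHomogeneous k) :
    Nat.card (zeros f) * (Fintype.card F - 1) =
      (Finset.univ.filter fun v => v ≠ 0 ∧ MvPolynomial.eval v f = 0).card := by
  have h := card_zeros_inter_zeros_mul hf (MvPolynomial.isHomogeneous_zero (Fin N) F 0)
  simpa only [zeros_zero, Set.inter_univ, map_zero, and_true] using h

theorem card_zeros_inter_zeros_eq_of_linearEquiv {f f' G G' : MvPolynomial (Fin N) F}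
    {k d : ℕ} (hf : f.IsHomogeneous k) (hf' : f'.IsHomogeneous k) (hG : G.IsHomogeneous d)
    (hG' : G'.IsHomogeneous d) (φ : (Fin N → F) ≃ₗ[F] (Fin N → F))
    (hφf : ∀ x, MvPolynomial.eval (φ x) f = MvPolynomial.eval x f')
    (hφG : ∀ x, MvPolynomial.eval (φ x) G = MvPolynomial.eval x G') :
    Nat.card ↥(zeros f ∩ zeros G) = Nat.card ↥(zeros f' ∩ zeros G') := by
  have hφ : Function.Injective (Projectivization.map φ.toLinearMap φ.injective) :=
    Projectivization.map_injective _ _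
  have hrange : Set.range (Projectivization.map φ.toLinearMap φ.injective) = Set.univ := by
    refine Set.eq_univ_of_forall (Projectivization.ind fun v hv => ?_)
    exact ⟨Projectivization.mk F (φ.symm v) (by simpa using hv), by simp [Projectivization.map_mk]⟩
  rw [← Nat.card_preimage_of_injective hφ (by simp [hrange])]
  congr 2
  ext P
  induction P using Projectivization.ind with | h v hv =>
  simp only [Set.mem_preimage, Set.mem_inter_iff, Projectivization.map_mk]
  rw [mk_mem_zeros_iff hf, mk_mem_zeros_iff hG, mk_mem_zeros_iff hf', mk_mem_zeros_iff hG',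
    LinearEquiv.coe_coe, hφf, hφG]

end Points

section Cone

variable {F : Type*} [Field F] {n : ℕ}

/-- The points of `ℙ^n`, parametrised as the points of the cone over `ℙ^(n-1)` with vertex
`(1 : 0 : ⋯ : 0)`: the vertex is `none`, and `some (P, t)` is the point of the line through the
vertex and `P` whose coordinate vector is `(t, normRep P)`. -/
noncomputable def conePoint : Option (ℙ F (Fin n → F) × F) → ℙ F (Fin (n + 1) → F)
  | none => Projectivization.mk F (Pi.single 0 1) (by simp)
  | some (P, t) => Projectivization.mk F (Fin.cons t (normRep P))
      fun h => normRep_ne_zero P (congrArg Fin.tail h)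

theorem conePoint_none_mem_zeros_iff {G : MvPolynomial (Fin (n + 1)) F} {d : ℕ}
    (hG : G.IsHomogeneous d) :
    conePoint none ∈ zeros G ↔ MvPolynomial.eval (Pi.single 0 1) G = 0 :=
  mk_mem_zeros_iff hG _

theorem conePoint_some_mem_zeros_iff {G : MvPolynomial (Fin (n + 1)) F} {d : ℕ}
    (hG : G.IsHomogeneous d) (P : ℙ F (Fin n → F)) (t : F) :
    conePoint (some (P, t)) ∈ zeros G ↔ MvPolynomial.eval (Fin.cons t (normRep P)) G = 0 :=
  mk_mem_zeros_iff hG _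

theorem conePoint_bijective :
    Function.Bijective (conePoint (F := F) (n := n)) := by
  refine ⟨?_, Projectivization.ind fun v hv => ?_⟩
  · rintro (_ | ⟨P, t⟩) (_ | ⟨P', t'⟩) h
    · rfl
    · obtain ⟨a, ha⟩ := (Projectivization.mk_eq_mk_iff' F _ _ _ _).1 h.symm
      exact absurd (funext fun i => by simpa using (congrFun ha i.succ).symm) (normRep_ne_zero P')
    · obtain ⟨a, ha⟩ := (Projectivization.mk_eq_mk_iff' F _ _ _ _).1 h
      exact absurd (funext fun i => by simpa using (congrFun ha i.succ).symm) (normRep_ne_zero P)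
    · obtain ⟨a, ha⟩ := (Projectivization.mk_eq_mk_iff' F _ _ _ _).1 h
      have htail : a • normRep P' = normRep P := congrArg Fin.tail ha
      obtain rfl : P = P' := by
        rw [← mk_normRep P, ← mk_normRep P', Projectivization.mk_eq_mk_iff']
        exact ⟨a, htail⟩
      have ha1 : a = 1 := smul_left_injective F (normRep_ne_zero P) (by simpa using htail)
      simpa [ha1] using (congrFun ha 0).symm
  · by_cases htail : Fin.tail v = 0
    · refine ⟨none, (Projectivization.mk_eq_mk_iff' F _ _ _ _).2 ⟨(v 0)⁻¹, ?_⟩⟩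
      have hv0 : v 0 ≠ 0 := fun h0 =>
        hv (funext (Fin.cases h0 (congrFun htail)))
      refine funext (Fin.cases (by simp [hv0]) fun i => ?_)
      have hi : v i.succ = 0 := congrFun htail i
      simp [hi]
    · obtain ⟨u, hu⟩ := (Projectivization.mk_eq_mk_iff F _ _ _ _).1
        (mk_normRep (Projectivization.mk F (Fin.tail v) htail))
      refine ⟨some (Projectivization.mk F _ htail, u • v 0),
        (Projectivization.mk_eq_mk_iff F _ _ _ _).2 ⟨u, ?_⟩⟩
      rw [← hu]
      exact funext (Fin.cases rfl fun i => rfl)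

variable [Fintype F]

open Classical in
theorem card_cone_inter_zeros [DecidableEq F] [Fintype (ℙ F (Fin n → F))]
    {f : MvPolynomial (Fin n) F} {G : MvPolynomial (Fin (n + 1)) F} {k d : ℕ}
    (hf : f.IsHomogeneous k) (hk : k ≠ 0) (hG : G.IsHomogeneous d) :
    Nat.card ↥(zeros (MvPolynomial.rename Fin.succ f) ∩ zeros G) =
      (if MvPolynomial.eval (Pi.single 0 1) G = 0 then 1 else 0) +
        ∑ P with P ∈ zeros f, (Finset.univ.filter fun t =>
          MvPolynomial.eval (Fin.cons t (normRep P)) G = 0).card := by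
  have hf' := hf.rename_isHomogeneous (f := Fin.succ)
  have htail (x : Fin (n + 1) → F) : MvPolynomial.eval x (MvPolynomial.rename Fin.succ f) =
      MvPolynomial.eval (Fin.tail x) f := MvPolynomial.eval_rename _ _ _
  have hnone : conePoint none ∈ zeros (MvPolynomial.rename Fin.succ f) := by
    have h := eval_smul_of_isHomogeneous hf 0 0
    rw [conePoint_none_mem_zeros_iff hf', htail]
    rw [smul_zero, zero_pow hk, zero_mul] at h
    convert h
    exact funext fun i => by simp [Fin.tail]
  have hsome (P : ℙ F (Fin n → F)) (t : F) :
      conePoint (some (P, t)) ∈ zeros (MvPolynomial.rename Fin.succ f) ↔ P ∈ zeros f := by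
    rw [conePoint_some_mem_zeros_iff hf', htail, Fin.tail_cons]
    rfl
  rw [← Nat.card_preimage_of_injective conePoint_bijective.injective
    (by simp [conePoint_bijective.surjective.range_eq]), Set.preimage_inter,
    Nat.card_eq_fintype_card, Fintype.card_subtype, Finset.card_filter, Fintype.sum_option,
    Fintype.sum_prod_type, Finset.sum_filter]
  simp only [Set.mem_inter_iff, Set.mem_preimage, hnone, hsome, conePoint_none_mem_zeros_iff hG,
    conePoint_some_mem_zeros_iff hG, true_and, ite_and]
  congr 1
  refine Finset.sum_congr rfl fun P _ => ?_
  split_ifs <;> simp only [Finset.card_filter, Finset.sum_const_zero]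

theorem card_cone {f : MvPolynomial (Fin n) F} {k : ℕ} (hf : f.IsHomogeneous k) (hk : k ≠ 0) :
    Nat.card (zeros (MvPolynomial.rename Fin.succ f)) =
      1 + Fintype.card F * Nat.card (zeros f) := by
  classical
  have : Fintype (ℙ F (Fin n → F)) := Fintype.ofFinite _
  have h := card_cone_inter_zeros hf hk (MvPolynomial.isHomogeneous_zero (Fin (n + 1)) F 0)
  rw [zeros_zero, Set.inter_univ] at h
  rw [h, Nat.card_eq_fintype_card, Fintype.card_subtype]
  simp [mul_comm]

end Cone

section LeadingCoefficient

variable {R : Type*} [CommRing R] {n : ℕ}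

theorem eval_ne_zero_of_isHomogeneous_zero {ι : Type*} {g : MvPolynomial ι R}
    (hg : g.IsHomogeneous 0) (hg0 : g ≠ 0) (x : ι → R) : MvPolynomial.eval x g ≠ 0 := by
  have hgC := MvPolynomial.totalDegree_eq_zero_iff_eq_C.1 (Nat.le_zero.1 hg.totalDegree_le)
  rw [hgC, MvPolynomial.eval_C]
  exact fun h0 => hg0 (by rw [hgC, h0, map_zero])

theorem natDegree_finSuccEquiv_le {G : MvPolynomial (Fin (n + 1)) R} {d : ℕ}
    (hG : G.IsHomogeneous d) : (MvPolynomial.finSuccEquiv R n G).natDegree ≤ d := by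
  rw [MvPolynomial.natDegree_finSuccEquiv]
  exact (MvPolynomial.degreeOf_le_totalDegree _ _).trans hG.totalDegree_le

theorem isHomogeneous_leadingCoeff_finSuccEquiv {G : MvPolynomial (Fin (n + 1)) R} {d : ℕ}
    (hG : G.IsHomogeneous d) : (MvPolynomial.finSuccEquiv R n G).leadingCoeff.IsHomogeneous
      (d - (MvPolynomial.finSuccEquiv R n G).natDegree) :=
  hG.finSuccEquiv_coeff_isHomogeneous _ _ (Nat.add_sub_cancel' (natDegree_finSuccEquiv_le hG))

theorem card_eval_cons_eq_zero_le [IsDomain R] [Fintype R] [DecidableEq R]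
    {G : MvPolynomial (Fin (n + 1)) R} {x : Fin n → R}
    (hx : MvPolynomial.eval x (MvPolynomial.finSuccEquiv R n G).leadingCoeff ≠ 0) :
    (Finset.univ.filter fun t => MvPolynomial.eval (Fin.cons t x) G = 0).card ≤
      (MvPolynomial.finSuccEquiv R n G).natDegree := by
  set p := MvPolynomial.finSuccEquiv R n G
  have hpx : p.map (MvPolynomial.eval x) ≠ 0 := fun h0 => hx <| by
    simpa using congrArg (Polynomial.coeff · p.natDegree) h0
  refine le_trans (Polynomial.card_le_degree_of_subset_roots (p := p.map (MvPolynomial.eval x)) ?_)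
    Polynomial.natDegree_map_le
  intro t ht
  rw [Finset.mem_val, Finset.mem_filter, MvPolynomial.eval_eq_eval_mv_eval'] at ht
  exact (Polynomial.mem_roots hpx).2 ht.2

theorem eval_single_zero_one_ne_zero {G : MvPolynomial (Fin (n + 1)) R} {d : ℕ}
    (hG : G.IsHomogeneous d) (hG0 : G ≠ 0)
    (hd : (MvPolynomial.finSuccEquiv R n G).natDegree = d) :
    MvPolynomial.eval (Pi.single 0 1) G ≠ 0 := by
  set p := MvPolynomial.finSuccEquiv R n G with hp
  have hlower : ∑ i ∈ Finset.range d, MvPolynomial.eval 0 (p.coeff i) * 1 ^ i = 0 := by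
    refine Finset.sum_eq_zero fun i hi => ?_
    have hi := Finset.mem_range.1 hi
    have h := eval_smul_of_isHomogeneous
      (hG.finSuccEquiv_coeff_isHomogeneous i (d - i) (by omega)) 0 0
    rw [smul_zero, zero_pow (by omega), zero_mul] at h
    rw [h, zero_mul]
  have hlead : p.leadingCoeff.IsHomogeneous 0 := by
    simpa only [← hp, hd, Nat.sub_self] using isHomogeneous_leadingCoeff_finSuccEquiv hG
  have hvertex : (Pi.single 0 1 : Fin (n + 1) → R) = Fin.cons 1 0 :=
    funext (Fin.cases (by simp) fun i => by simp)
  rw [hvertex, MvPolynomial.eval_eq_eval_mv_eval', Polynomial.eval_map,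
    Polynomial.eval₂_eq_sum_range, ← hp, hd, Finset.sum_range_succ, hlower, zero_add, one_pow,
    mul_one, ← hd]
  exact eval_ne_zero_of_isHomogeneous_zero hlead (Polynomial.leadingCoeff_ne_zero.2 (by simpa [hp]))
    0

end LeadingCoefficient

section ConeSection

variable {F : Type*} [Field F] [Fintype F] {n : ℕ}

/-- Over a point `P` of the base with `g(P) ≠ 0`, where `g` is the leading coefficient of `G` in
the direction of the vertex, `G` has at most `j` zeros on the line through `P`; the other lines are
bounded trivially. The vertex is a zero of `G` only if `j < d`. -/
theorem card_cone_inter_zeros_add_le {f : MvPolynomial (Fin n) F} {k : ℕ}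
    (hf : f.IsHomogeneous k) (hk : k ≠ 0) {G : MvPolynomial (Fin (n + 1)) F} {d : ℕ}
    (hG : G.IsHomogeneous d) (hG0 : G ≠ 0) {j : ℕ} {g : MvPolynomial (Fin n) F}
    (hj : (MvPolynomial.finSuccEquiv F n G).natDegree = j)
    (hg : (MvPolynomial.finSuccEquiv F n G).leadingCoeff = g) :
    Nat.card ↥(zeros (MvPolynomial.rename Fin.succ f) ∩ zeros G) +
        j * Nat.card ↥(zeros f ∩ zeros g) ≤
      min (d - j) 1 + Fintype.card F * Nat.card ↥(zeros f ∩ zeros g) +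
        j * Nat.card (zeros f) := by
  classical
  have : Fintype (ℙ F (Fin n → F)) := Fintype.ofFinite _
  have hvertex : (if MvPolynomial.eval (Pi.single 0 1) G = 0 then 1 else 0) ≤ min (d - j) 1 := by
    split_ifs with h
    · have hjd : j ≠ d := fun hjd => eval_single_zero_one_ne_zero hG hG0 (hj.trans hjd) h
      have := natDegree_finSuccEquiv_le hG
      omega
    · exact Nat.zero_le _
  have hfibre (P : ℙ F (Fin n → F)) :
      (Finset.univ.filter fun t => MvPolynomial.eval (Fin.cons t (normRep P)) G = 0).card +
        j * (if P ∈ zeros g then 1 else 0) ≤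
      Fintype.card F * (if P ∈ zeros g then 1 else 0) + j := by
    split_ifs with hP
    · have := Finset.card_le_univ
        (Finset.univ.filter fun t => MvPolynomial.eval (Fin.cons t (normRep P)) G = 0)
      omega
    · have := card_eval_cons_eq_zero_le (G := G) (x := normRep P) (by rwa [hg])
      omega
  have hsum := Finset.sum_le_sum fun P (_ : P ∈ Finset.univ.filter (· ∈ zeros f)) => hfibre P
  have hfg : Nat.card ↥(zeros f ∩ zeros g) =
      ∑ P with P ∈ zeros f, if P ∈ zeros g then 1 else 0 := by
    rw [Finset.sum_boole, Finset.filter_filter, Nat.card_eq_fintype_card, Fintype.card_subtype]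
    rfl
  have hzf : Nat.card (zeros f) = (Finset.univ.filter (· ∈ zeros f)).card := by
    rw [Nat.card_eq_fintype_card, Fintype.card_subtype]
  rw [Finset.sum_add_distrib, Finset.sum_add_distrib, ← Finset.mul_sum, ← Finset.mul_sum,
    Finset.sum_const, ← hfg, ← hzf, smul_eq_mul, mul_comm _ j] at hsum
  rw [card_cone_inter_zeros hf hk hG]
  omega

end ConeSection

section Counting

variable {F : Type*} [Field F] [Fintype F] {q n : ℕ}

theorem card_pow_succ_eq_add [DecidableEq F] (hF : Fintype.card F = q ^ 2) {c : F}
    (hc : c ^ q = c) :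
    (Finset.univ.filter fun t : F => t ^ (q + 1) = c).card + q * (if c = 0 then 1 else 0) =
      q + 1 := by
  split_ifs with h
  · simp [h, Finset.filter_eq', add_comm]
  · rw [card_pow_succ_eq hF h hc, mul_zero, add_zero]

theorem sum_pow_succ_pow_eq (hF : Fintype.card F = q ^ 2) (x : Fin n → F) :
    (∑ i, x i ^ (q + 1)) ^ q = ∑ i, x i ^ (q + 1) := by
  obtain ⟨σ, hσ⟩ := exists_ringHom_eq_pow hF
  rw [← hσ, map_sum]
  refine Finset.sum_congr rfl fun i _ => ?_
  rw [map_pow, hσ, pow_succ, pow_q_pow_q hF, pow_succ, mul_comm]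

theorem card_sum_pow_succ_eq_zero_succ [DecidableEq F] (hF : Fintype.card F = q ^ 2) (n : ℕ) :
    (Finset.univ.filter fun x : Fin (n + 1) → F => ∑ i, x i ^ (q + 1) = 0).card +
        q * (Finset.univ.filter fun x : Fin n → F => ∑ i, x i ^ (q + 1) = 0).card =
      (q + 1) * (q ^ 2) ^ n := by
  obtain ⟨σ, hσ⟩ := exists_ringHom_eq_pow hF
  have hfibre (x : Fin n → F) := card_pow_succ_eq_add hF (c := -∑ i, x i ^ (q + 1))
    (by rw [← hσ, map_neg, hσ, sum_pow_succ_pow_eq hF])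
  have hcons : (Finset.univ.filter fun x : Fin (n + 1) → F => ∑ i, x i ^ (q + 1) = 0).card =
      ∑ x : Fin n → F,
        (Finset.univ.filter fun t : F => t ^ (q + 1) = -∑ i, x i ^ (q + 1)).card := by
    rw [Finset.card_filter, ← (Fin.consEquiv fun _ => F).sum_comp, Fintype.sum_prod_type_right]
    simp only [Fin.consEquiv_apply, Fin.sum_univ_succ, Fin.cons_zero, Fin.cons_succ,
      Finset.card_filter, add_eq_zero_iff_eq_neg]
  simp only [neg_eq_zero] at hfibre
  rw [hcons, Finset.card_filter, Finset.mul_sum, ← Finset.sum_add_distrib,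
    Finset.sum_congr rfl fun x _ => hfibre x]
  simp [hF, mul_comm]

theorem mul_card_sum_pow_succ_eq_zero [DecidableEq F] (hF : Fintype.card F = q ^ 2) (n : ℕ) :
    (q : ℤ) * (Finset.univ.filter fun x : Fin n → F => ∑ i, x i ^ (q + 1) = 0).card =
      q ^ (2 * n) + (-1) ^ n * (q - 1) * q ^ n := by
  induction n with
  | zero => simp
  | succ n ih =>
    have h : ((_ : ℕ) : ℤ) = (_ : ℕ) := congrArg Nat.cast (card_sum_pow_succ_eq_zero_succ hF n)
    push_cast [← pow_mul] at h
    rw [mul_add_one 2 n, pow_add]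
    linear_combination (q : ℤ) * h - (q : ℤ) * ih

variable {H : Matrix (Fin n) (Fin n) F}

theorem exists_linearEquiv_eval_hermitianForm_eq_sum (hF : Fintype.card F = q ^ 2)
    (hH : IsHermitianMatrix q H) (hrank : H.rank = n) :
    ∃ φ : (Fin n → F) ≃ₗ[F] (Fin n → F), ∀ x,
      MvPolynomial.eval (φ x) (hermitianForm q H) = ∑ i, x i ^ (q + 1) := by
  obtain ⟨σ, hσ⟩ := exists_ringHom_eq_pow hF
  have hσ' : Function.Involutive σ := fun x => by rw [hσ, hσ, pow_q_pow_q hF]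
  have hone (x y : Fin n → F) : sesqForm σ 1 x y = ∑ i, y i * σ (x i) := by
    simp [sesqForm_apply, Matrix.one_apply]
  have hsymm : (sesqForm σ (1 : Matrix (Fin n) (Fin n) F)).IsSymm :=
    ⟨fun x y => by simp only [hone, map_sum, map_mul, hσ' _, mul_comm]⟩
  have hB := hH.isSymm_sesqForm hσ hσ'
  obtain ⟨φ, hφ⟩ := exists_isometry (B := sesqForm σ (1 : Matrix (Fin n) (Fin n) F))
    (B' := sesqForm σ H)
    (by simpa only [hσ] using exists_add_pow_ne_zero hF)
    (fun c hc hcσ => by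
      simpa only [hσ, ← pow_succ] using exists_pow_succ_eq hF hc ((hσ c).symm.trans hcσ))
    hsymm hB rfl
    (by rw [ker_sesqForm_eq_bot hsymm Matrix.rank_one, ker_sesqForm_eq_bot hB (by simpa)])
  refine ⟨φ, fun x => ?_⟩
  rw [eval_hermitianForm hσ, hφ, hone]
  exact Finset.sum_congr rfl fun i _ => by rw [hσ, pow_succ, mul_comm]

theorem card_hermitianVariety_mul_add_one [DecidableEq F] (hF : Fintype.card F = q ^ 2)
    (hH : IsHermitianMatrix q H) (hrank : H.rank = n) :
    Nat.card (hermitianVariety q H) * (q ^ 2 - 1) + 1 =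
      (Finset.univ.filter fun x : Fin n → F => ∑ i, x i ^ (q + 1) = 0).card := by
  obtain ⟨φ, hφ⟩ := exists_linearEquiv_eval_hermitianForm_eq_sum hF hH hrank
  have hcard : (Finset.univ.filter fun v => v ≠ 0 ∧
      MvPolynomial.eval v (hermitianForm q H) = 0).card =
        (Finset.univ.filter fun x : Fin n → F => x ≠ 0 ∧ ∑ i, x i ^ (q + 1) = 0).card :=
    (Finset.card_equiv φ.toEquiv fun x => by simp [← hφ]).symm
  have h0 : (0 : Fin n → F) ∈ Finset.univ.filter fun x => ∑ i, x i ^ (q + 1) = 0 := by simp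
  rw [hermitianVariety, ← hF, card_zeros_mul isHomogeneous_hermitianForm, hcard,
    ← Finset.card_erase_add_one h0]
  congr 2
  ext x
  simp

theorem card_hermitianVariety_mul (hF : Fintype.card F = q ^ 2) (hH : IsHermitianMatrix q H)
    (hrank : H.rank = n) :
    (Nat.card (hermitianVariety q H) : ℤ) * (q ^ 2 - 1) =
      (q ^ (n - 1) - (-1) ^ (n - 1)) * (q ^ n - (-1) ^ n) := by
  classical
  have hq := two_le_of_card_eq_sq hF
  have hcard : ((_ : ℕ) : ℤ) = (_ : ℕ) :=
    congrArg Nat.cast (card_hermitianVariety_mul_add_one hF hH hrank)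
  have hqN := mul_card_sum_pow_succ_eq_zero hF n
  rw [← hcard] at hqN
  push_cast [Nat.one_le_pow 2 q (by omega)] at hqN
  have hq0 : (q : ℤ) ≠ 0 := by exact_mod_cast (by omega : q ≠ 0)
  refine mul_left_cancel₀ hq0 ?_
  rcases n with _ | n
  · linear_combination hqN
  · have hsq : ((-1) ^ n : ℤ) ^ 2 = 1 := by rw [← pow_mul, mul_comm, pow_mul]; simp
    rw [Nat.add_sub_cancel]
    linear_combination hqN + (q : ℤ) * hsq

end Counting

section MaxSection

variable {F : Type*} [Field F]

theorem card_inter_zeros_le_maxSection [Finite F] {N d : ℕ} (X : Set (ℙ F (Fin N → F)))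
    {G : MvPolynomial (Fin N) F} (hG : G.IsHomogeneous d) (hG0 : G ≠ 0) :
    Nat.card ↥(X ∩ zeros G) ≤ maxSection X d := by
  refine le_csSup ⟨Nat.card X, ?_⟩ ⟨G, hG0, hG, rfl⟩
  rintro k ⟨G', -, -, rfl⟩
  exact Nat.card_mono (Set.toFinite X) Set.inter_subset_left

theorem exists_isHomogeneous_forall_mem_zeros_of_fin_two (S : Finset (ℙ F (Fin 2 → F))) :
    ∃ G : MvPolynomial (Fin 2) F, G.IsHomogeneous S.card ∧ G ≠ 0 ∧ ∀ P ∈ S, P ∈ zeros G := by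
  let l (P : ℙ F (Fin 2 → F)) : MvPolynomial (Fin 2) F :=
    MvPolynomial.C (normRep P 1) * MvPolynomial.X 0 -
      MvPolynomial.C (normRep P 0) * MvPolynomial.X 1
  have hl (P) : (l P).IsHomogeneous 1 :=
    (MvPolynomial.isHomogeneous_C_mul_X _ _).sub (MvPolynomial.isHomogeneous_C_mul_X _ _)
  refine ⟨∏ P ∈ S, l P, by simpa using MvPolynomial.IsHomogeneous.prod S l 1 fun P _ => hl P,
    Finset.prod_ne_zero_iff.2 fun P _ h0 => normRep_ne_zero P ?_, fun P hP => ?_⟩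
  · have h1 := congrArg (MvPolynomial.eval ![1, 0]) h0
    have h2 := congrArg (MvPolynomial.eval ![0, 1]) h0
    exact funext (Fin.forall_fin_two.2 ⟨by simpa [l] using h2, by simpa [l] using h1⟩)
  · refine (map_prod _ _ _).trans (Finset.prod_eq_zero hP ?_)
    simp [l, mul_comm]

theorem le_maxSection_of_fin_two [Finite F] {d : ℕ} {X : Set (ℙ F (Fin 2 → F))}
    (hd : d ≤ Nat.card X) : d ≤ maxSection X d := by
  obtain ⟨S, hSX, rfl⟩ := Set.exists_subset_card_eq (Nat.card_coe_set_eq X ▸ hd)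
  obtain ⟨G, hG, hG0, hSG⟩ :=
    exists_isHomogeneous_forall_mem_zeros_of_fin_two (Set.toFinite S).toFinset
  rw [← Set.ncard_eq_toFinset_card] at hG
  refine le_trans ?_ (card_inter_zeros_le_maxSection X hG hG0)
  rw [← Nat.card_coe_set_eq]
  exact Nat.card_mono (Set.toFinite _) fun P hP => ⟨hSX hP, hSG P (by simpa using hP)⟩

end MaxSection

section ProjectiveLine

variable {F : Type*} [Field F]

theorem zeros_eq_empty_of_fin_one {g : MvPolynomial (Fin 1) F} {e : ℕ} (hg : g.IsHomogeneous e)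
    (hg0 : g ≠ 0) : zeros g = ∅ := by
  have hlead0 := Polynomial.leadingCoeff_ne_zero.2
    (show MvPolynomial.finSuccEquiv F 0 g ≠ 0 by simpa using hg0)
  have hlead := isHomogeneous_leadingCoeff_finSuccEquiv hg
  rw [MvPolynomial.eq_C_of_isEmpty (MvPolynomial.finSuccEquiv F 0 g).leadingCoeff] at hlead hlead0
  have hdegree := hlead.inj_right (MvPolynomial.isHomogeneous_C _ _) hlead0
  have hvertex := eval_single_zero_one_ne_zero hg hg0
    (le_antisymm (natDegree_finSuccEquiv_le hg) (Nat.sub_eq_zero_iff_le.1 hdegree))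
  refine Set.eq_empty_of_forall_notMem fun P hP => ?_
  have hP0 : normRep P = normRep P 0 • Pi.single 0 1 := by
    ext i
    simp [Subsingleton.elim i 0]
  rw [zeros, Set.mem_ofPred_eq, hP0, eval_smul_of_isHomogeneous hg, mul_eq_zero,
    or_iff_left hvertex] at hP
  exact normRep_ne_zero P (by rw [hP0, eq_zero_of_pow_eq_zero hP, zero_smul])

theorem card_projectivization_fin_one [Finite F] : Nat.card (ℙ F (Fin 1 → F)) = 1 := by
  have h := Projectivization.card F (Fin 1 → F)
  rw [Nat.card_congr (Equiv.funUnique (Fin 1) F)] at h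
  exact (Nat.mul_eq_right (Nat.sub_pos_of_lt Finite.one_lt_card).ne').1 h.symm

theorem card_zeros_le_of_fin_two [Finite F] {g : MvPolynomial (Fin 2) F} {e : ℕ}
    (hg : g.IsHomogeneous e) (hg0 : g ≠ 0) : Nat.card (zeros g) ≤ e := by
  have := Fintype.ofFinite F
  have hlead0 := Polynomial.leadingCoeff_ne_zero.2
    (show MvPolynomial.finSuccEquiv F 1 g ≠ 0 by simpa using hg0)
  have hcone := card_cone_inter_zeros_add_le (MvPolynomial.isHomogeneous_zero (Fin 1) F 1)
    one_ne_zero hg hg0 rfl rfl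
  simp only [zeros_eq_empty_of_fin_one (isHomogeneous_leadingCoeff_finSuccEquiv hg) hlead0,
    map_zero, zeros_zero, Set.inter_empty, Set.univ_inter, Nat.card_univ,
    card_projectivization_fin_one, Nat.card_of_isEmpty, mul_zero, add_zero, mul_one] at hcone
  have := natDegree_finSuccEquiv_le hg
  omega

end ProjectiveLine

section HermitianSections

variable {F : Type*} [Field F] [Fintype F] {q n : ℕ} {H : Matrix (Fin n) (Fin n) F}

theorem card_hermitianVariety_of_fin_two {H : Matrix (Fin 2) (Fin 2) F}
    (hF : Fintype.card F = q ^ 2) (hH : IsHermitianMatrix q H) (hrank : H.rank = 2) :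
    Nat.card (hermitianVariety q H) = q + 1 := by
  have h := card_hermitianVariety_mul hF hH hrank
  have hq : (2 : ℤ) ≤ q := by exact_mod_cast two_le_of_card_eq_sq hF
  have hcard : (Nat.card (hermitianVariety q H) : ℤ) = q + 1 := by
    refine mul_right_cancel₀ (b := (q : ℤ) ^ 2 - 1) (by nlinarith) ?_
    rw [h]
    ring
  exact_mod_cast hcard

theorem card_hermitianVariety_le (hF : Fintype.card F = q ^ 2) (hn : 2 ≤ n)
    (hH : IsHermitianMatrix q H) (hrank : H.rank = n) :
    Nat.card (hermitianVariety q H) ≤ (q + 1) * q ^ (2 * n - 4) := by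
  obtain ⟨k, rfl⟩ := Nat.exists_eq_add_of_le' hn
  have hcard := card_hermitianVariety_mul hF hH hrank
  rw [show k + 2 - 1 = k + 1 by omega] at hcard
  rw [show 2 * (k + 2) - 4 = k * 2 by omega, pow_mul]
  have hq : (2 : ℤ) ≤ q := by exact_mod_cast two_le_of_card_eq_sq hF
  have hr : (1 : ℤ) ≤ q ^ k := one_le_pow₀ (by linarith)
  have hs : (-1 : ℤ) ^ k ≤ 1 := (le_abs_self _).trans_eq (abs_neg_one_pow k)
  have hdiff : ((q : ℤ) + 1) * (q ^ k) ^ 2 * (q ^ 2 - 1) -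
      (q ^ (k + 1) - (-1) ^ (k + 1)) * (q ^ (k + 2) - (-1) ^ (k + 2)) =
        ((q ^ 2 - q - 1) * q ^ k - (-1) ^ k) * (q ^ k - (-1) ^ k) := by
    ring
  have hfactor : (-1 : ℤ) ^ k ≤ (q ^ 2 - q - 1) * q ^ k :=
    hs.trans (one_le_mul_of_one_le_of_one_le (by nlinarith) hr)
  have hdiff_nonneg := mul_nonneg (sub_nonneg.2 hfactor) (sub_nonneg.2 (hs.trans hr))
  zify
  refine le_of_mul_le_mul_right ?_ (by nlinarith : (0 : ℤ) < q ^ 2 - 1)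
  linarith

theorem card_hermitianVariety_inter_zeros_mul_le (hF : Fintype.card F = q ^ 2) (hn : 3 ≤ n)
    (hH : IsHermitianMatrix q H) (hrank : H.rank = n) {g : MvPolynomial (Fin n) F} {e : ℕ}
    (hg : g.IsHomogeneous e) (he : e ≤ q) (hg0 : g ≠ 0) :
    Nat.card ↥(hermitianVariety q H ∩ zeros g) * (q ^ 2 - 1) ≤
      e * (q + 1) * (q ^ (2 * n - 4) - 1) := by
  classical
  obtain ⟨σ, hσ⟩ := exists_ringHom_eq_pow hF
  have hB := hH.isSymm_sesqForm hσ fun x => by rw [hσ, hσ, pow_q_pow_q hF]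
  have h := card_isotropic_section_le hF hσ hB (ker_sesqForm_eq_bot hB (by simpa using hrank))
    (by simpa using hn) hg he hg0
  simp only [← eval_hermitianForm hσ] at h
  rw [Fintype.card_fin, ← card_zeros_inter_zeros_mul isHomogeneous_hermitianForm hg, hF,
    ← pow_mul, show 2 * (n - 2) = 2 * n - 4 by omega] at h
  exact h

end HermitianSections

section LinearSubstitution

variable {F : Type*} [Field F]

theorem exists_isHomogeneous_forall_eval_eq [Finite F] {N d : ℕ}
    (φ : (Fin N → F) ≃ₗ[F] (Fin N → F)) {G : MvPolynomial (Fin N) F} (hG : G.IsHomogeneous d)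
    (hG0 : G ≠ 0) (hd : d ≤ Nat.card F) :
    ∃ G' : MvPolynomial (Fin N) F, G'.IsHomogeneous d ∧ G' ≠ 0 ∧
      ∀ x, MvPolynomial.eval (φ x) G = MvPolynomial.eval x G' := by
  have heval (x : Fin N → F) : MvPolynomial.eval (φ x) G =
      MvPolynomial.eval x (affineSubst 0 (fun i => φ (Pi.single i 1)) G) := by
    rw [eval_affineSubst, zero_add]
    conv_lhs => rw [pi_eq_sum_univ' x, map_sum]
    simp only [map_smul]
  refine ⟨_, isHomogeneous_affineSubst_zero _ hG, fun h0 => hG0 ?_, heval⟩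
  refine hG.eq_zero_of_forall_eval_eq_zero_of_le_card (φ.surjective.forall.2 fun x => ?_) ?_
  · rw [heval, h0, map_zero]
  · rwa [← Nat.cast_card, Nat.cast_le]

end LinearSubstitution

section ConeBounds

variable {F : Type*} [Field F] [Fintype F] {n k d : ℕ}

theorem card_cone_inter_zeros_lt {f : MvPolynomial (Fin n) F} (hf : f.IsHomogeneous k)
    (hk : k ≠ 0) {G : MvPolynomial (Fin (n + 1)) F} (hG : G.IsHomogeneous d) (hG0 : G ≠ 0)
    (hd : d < Fintype.card F) {P : ℙ F (Fin n → F)} (hPf : P ∈ zeros f)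
    (hP : P ∉ zeros (MvPolynomial.finSuccEquiv F n G).leadingCoeff) :
    Nat.card ↥(zeros (MvPolynomial.rename Fin.succ f) ∩ zeros G) <
      Nat.card (zeros (MvPolynomial.rename Fin.succ f)) := by
  have hsection := card_cone_inter_zeros_add_le hf hk hG hG0 rfl rfl
  have hdegree := (natDegree_finSuccEquiv_le hG).trans_lt hd
  have hlt : Nat.card ↥(zeros f ∩ zeros (MvPolynomial.finSuccEquiv F n G).leadingCoeff) <
      Nat.card (zeros f) := by
    simp only [Nat.card_coe_set_eq]
    exact Set.ncard_lt_ncard ⟨Set.inter_subset_left, fun h => hP (h hPf).2⟩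
  have hmin := min_le_right (d - (MvPolynomial.finSuccEquiv F n G).natDegree) 1
  rw [card_cone hf hk]
  nlinarith

theorem card_cone_inter_zeros_le_of_natDegree_eq_zero {f : MvPolynomial (Fin n) F}
    (hf : f.IsHomogeneous k) (hk : k ≠ 0) {G : MvPolynomial (Fin (n + 1)) F}
    (hG : G.IsHomogeneous d) (hG0 : G ≠ 0)
    (hdegree : (MvPolynomial.finSuccEquiv F n G).natDegree = 0) :
    Nat.card ↥(zeros (MvPolynomial.rename Fin.succ f) ∩ zeros G) ≤
      1 + Fintype.card F * maxSection (zeros f) d := by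
  have hsection := card_cone_inter_zeros_add_le hf hk hG hG0 hdegree rfl
  have hlead : (MvPolynomial.finSuccEquiv F n G).leadingCoeff.IsHomogeneous d := by
    simpa only [hdegree, Nat.sub_zero] using isHomogeneous_leadingCoeff_finSuccEquiv hG
  have hmax := Nat.mul_le_mul_left (Fintype.card F)
    (card_inter_zeros_le_maxSection (zeros f) hlead (by simpa using hG0))
  rw [zero_mul, zero_mul] at hsection
  omega

theorem card_cone_inter_zeros_le_of_fin_two {f : MvPolynomial (Fin 2) F}
    (hf : f.IsHomogeneous k) (hk : k ≠ 0) {G : MvPolynomial (Fin 3) F}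
    (hG : G.IsHomogeneous d) (hG0 : G ≠ 0) (hd : d ≤ Nat.card (zeros f))
    (hcard : Nat.card (zeros f) ≤ Fintype.card F) :
    Nat.card ↥(zeros (MvPolynomial.rename Fin.succ f) ∩ zeros G) ≤
      1 + Fintype.card F * maxSection (zeros f) d := by
  obtain ⟨e, he⟩ := Nat.exists_eq_add_of_le (natDegree_finSuccEquiv_le hG)
  have hsection := card_cone_inter_zeros_add_le hf hk hG hG0 rfl rfl
  have hlead := isHomogeneous_leadingCoeff_finSuccEquiv hG
  set j := (MvPolynomial.finSuccEquiv F 2 G).natDegree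
  set g := (MvPolynomial.finSuccEquiv F 2 G).leadingCoeff with hg
  rw [he, Nat.add_sub_cancel_left] at hlead hsection
  have hbase : Nat.card ↥(zeros f ∩ zeros g) ≤ e :=
    (Nat.card_mono (Set.toFinite _) Set.inter_subset_right).trans
      (card_zeros_le_of_fin_two hlead (by simpa [hg] using hG0))
  have hmax := le_maxSection_of_fin_two hd
  have hmin := min_le_right e 1
  nlinarith [Nat.mul_le_mul_left j hcard, Nat.mul_le_mul_left (Fintype.card F) hbase,
    Nat.mul_le_mul_left (Fintype.card F) hmax]

end ConeBounds

section HermitianCone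

variable {F : Type*} [Field F] [Fintype F] {q n d : ℕ} {H : Matrix (Fin n) (Fin n) F}

theorem exists_mem_hermitianVariety_notMem_zeros (hF : Fintype.card F = q ^ 2) (hn : 2 ≤ n)
    (hH : IsHermitianMatrix q H) (hrank : H.rank = n) {g : MvPolynomial (Fin n) F} {e : ℕ}
    (hg : g.IsHomogeneous e) (he : e ≤ q) (hg0 : g ≠ 0) :
    ∃ P ∈ hermitianVariety q H, P ∉ zeros g := by
  obtain ⟨σ, hσ⟩ := exists_ringHom_eq_pow hF
  have hB := hH.isSymm_sesqForm hσ fun x => by rw [hσ, hσ, pow_q_pow_q hF]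
  obtain ⟨x, hx0, hxH, hxg⟩ := exists_isotropic_eval_ne_zero hF hσ hB
    (ker_sesqForm_eq_bot hB (by simpa using hrank)) (by simpa using hn) hg he hg0
  exact ⟨Projectivization.mk F x hx0,
    (mk_mem_zeros_iff isHomogeneous_hermitianForm hx0).2 (by rwa [eval_hermitianForm hσ]),
    fun h => hxg ((mk_mem_zeros_iff hg hx0).1 h)⟩

theorem card_hermitianCone_inter_zeros_le_of_natDegree_ne_zero (hF : Fintype.card F = q ^ 2)
    (hn : 3 ≤ n) (hH : IsHermitianMatrix q H) (hrank : H.rank = n)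
    {G : MvPolynomial (Fin (n + 1)) F} (hG : G.IsHomogeneous d) (hd : d ≤ q) (hG0 : G ≠ 0)
    (hdegree : (MvPolynomial.finSuccEquiv F n G).natDegree ≠ 0) :
    (Nat.card ↥(zeros (MvPolynomial.rename Fin.succ (hermitianForm q H)) ∩ zeros G) : ℤ) ≤
      Nat.card (hermitianVariety q H) + ((d : ℤ) - 1) * (q + 1) * q ^ (2 * n - 4) := by
  obtain ⟨e, he⟩ := Nat.exists_eq_add_of_le (natDegree_finSuccEquiv_le hG)
  have hsection := card_cone_inter_zeros_add_le (isHomogeneous_hermitianForm (q := q) (H := H))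
    q.succ_ne_zero hG hG0 rfl rfl
  have hlead := isHomogeneous_leadingCoeff_finSuccEquiv hG
  set j := (MvPolynomial.finSuccEquiv F n G).natDegree
  set g := (MvPolynomial.finSuccEquiv F n G).leadingCoeff with hg
  rw [he, Nat.add_sub_cancel_left] at hlead hsection
  have hbase := card_hermitianVariety_inter_zeros_mul_le hF hn hH hrank hlead (by omega)
    (by simpa [hg] using hG0)
  have hvariety := card_hermitianVariety_le hF (by omega) hH hrank
  have hq := two_le_of_card_eq_sq hF
  have hvertex : min e 1 ≤ e * (q + 1) :=
    (min_le_left e 1).trans (Nat.le_mul_of_pos_right e q.succ_pos)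
  have hj : (1 : ℤ) ≤ j := by exact_mod_cast Nat.one_le_iff_ne_zero.2 hdegree
  zify [Nat.one_le_pow 2 q (by omega), Nat.one_le_pow (2 * n - 4) q (by omega)] at *
  have hvariety_nonneg := mul_nonneg (sub_nonneg.2 hj) (sub_nonneg.2 hvariety)
  have hsection_nonneg := mul_nonneg (sub_nonneg.2 hj)
    (Int.natCast_nonneg (Nat.card ↥(hermitianVariety q H ∩ zeros g)))
  simp only [hermitianVariety] at *
  rw [hF] at hsection
  rw [he]
  linarith

theorem card_hermitianCone_inter_zeros_le (hF : Fintype.card F = q ^ 2) (hn : 2 ≤ n)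
    (hH : IsHermitianMatrix q H) (hrank : H.rank = n)
    {G : MvPolynomial (Fin (n + 1)) F} (hG : G.IsHomogeneous d) (hd : d ≤ q) (hG0 : G ≠ 0) :
    (Nat.card ↥(zeros (MvPolynomial.rename Fin.succ (hermitianForm q H)) ∩ zeros G) : ℤ) ≤
      max ((Nat.card (hermitianVariety q H) : ℤ) + ((d : ℤ) - 1) * (q + 1) * q ^ (2 * n - 4))
        (1 + q ^ 2 * (maxSection (hermitianVariety q H) d : ℤ)) := by
  rcases hn.eq_or_lt with rfl | hn3
  · refine le_max_of_le_right ?_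
    have hcard := card_hermitianVariety_of_fin_two hF hH hrank
    have hq := two_le_of_card_eq_sq hF
    rw [hermitianVariety] at hcard
    exact_mod_cast hF ▸ card_cone_inter_zeros_le_of_fin_two isHomogeneous_hermitianForm
      q.succ_ne_zero hG hG0 (by omega) (by rw [hcard, hF]; nlinarith)
  by_cases hdegree : (MvPolynomial.finSuccEquiv F n G).natDegree = 0
  · refine le_max_of_le_right ?_
    exact_mod_cast hF ▸ card_cone_inter_zeros_le_of_natDegree_eq_zero
      isHomogeneous_hermitianForm q.succ_ne_zero hG hG0 hdegree
  · exact le_max_of_le_left (card_hermitianCone_inter_zeros_le_of_natDegree_ne_zero hF hn3 hH hrank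
      hG hd hG0 hdegree)

end HermitianCone

section StandardCone

variable {F : Type*} [Field F] [Fintype F] {q n d : ℕ}
  {H : Matrix (Fin (n + 1)) (Fin (n + 1)) F} {H' : Matrix (Fin n) (Fin n) F}

theorem exists_card_hermitianVariety_inter_zeros_eq (hF : Fintype.card F = q ^ 2)
    (hH : IsHermitianMatrix q H) (hrank : H.rank = n) (hH' : IsHermitianMatrix q H')
    (hrank' : H'.rank = n) {G : MvPolynomial (Fin (n + 1)) F} (hG : G.IsHomogeneous d)
    (hG0 : G ≠ 0) (hd : d ≤ Fintype.card F) :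
    ∃ G' : MvPolynomial (Fin (n + 1)) F, G'.IsHomogeneous d ∧ G' ≠ 0 ∧
      Nat.card ↥(hermitianVariety q H ∩ zeros G) =
        Nat.card ↥(zeros (MvPolynomial.rename Fin.succ (hermitianForm q H')) ∩ zeros G') := by
  obtain ⟨φ, hφ⟩ := exists_linearEquiv_eval_hermitianForm_eq_tail hF hH hrank hH' hrank'
  obtain ⟨G', hG', hG'0, hφG⟩ :=
    exists_isHomogeneous_forall_eval_eq φ hG hG0 (by rwa [Nat.card_eq_fintype_card])
  exact ⟨G', hG', hG'0, card_zeros_inter_zeros_eq_of_linearEquiv isHomogeneous_hermitianForm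
    isHomogeneous_hermitianForm.rename_isHomogeneous hG hG' φ
    (fun x => (hφ x).trans (MvPolynomial.eval_rename _ _ _).symm) hφG⟩

theorem card_hermitianVariety_eq_card_cone (hF : Fintype.card F = q ^ 2)
    (hH : IsHermitianMatrix q H) (hrank : H.rank = n) (hH' : IsHermitianMatrix q H')
    (hrank' : H'.rank = n) :
    Nat.card (hermitianVariety q H) =
      Nat.card (zeros (MvPolynomial.rename Fin.succ (hermitianForm q H'))) := by
  obtain ⟨φ, hφ⟩ := exists_linearEquiv_eval_hermitianForm_eq_tail hF hH hrank hH' hrank'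
  have h0 := MvPolynomial.isHomogeneous_zero (Fin (n + 1)) F 0
  simpa only [hermitianVariety, zeros_zero, Set.inter_univ] using
    card_zeros_inter_zeros_eq_of_linearEquiv isHomogeneous_hermitianForm
      isHomogeneous_hermitianForm.rename_isHomogeneous h0 h0 φ
      (fun x => (hφ x).trans (MvPolynomial.eval_rename _ _ _).symm) fun x => by simp

theorem card_hermitianVariety_eq (hF : Fintype.card F = q ^ 2)
    (hH : IsHermitianMatrix q H) (hrank : H.rank = n) (hH' : IsHermitianMatrix q H')
    (hrank' : H'.rank = n) :
    (Nat.card (hermitianVariety q H) : ℚ) = 1 + (q : ℚ) ^ 2 *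
      (((q : ℚ) ^ (n - 1) - (-1) ^ (n - 1)) * ((q : ℚ) ^ n - (-1) ^ n) / ((q : ℚ) ^ 2 - 1)) := by
  have hbase : (Nat.card (hermitianVariety q H') : ℚ) * ((q : ℚ) ^ 2 - 1) =
      ((q : ℚ) ^ (n - 1) - (-1) ^ (n - 1)) * ((q : ℚ) ^ n - (-1) ^ n) := by
    exact_mod_cast card_hermitianVariety_mul hF hH' hrank'
  have hq : (2 : ℚ) ≤ q := by exact_mod_cast two_le_of_card_eq_sq hF
  rw [card_hermitianVariety_eq_card_cone hF hH hrank hH' hrank',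
    card_cone isHomogeneous_hermitianForm q.succ_ne_zero, hF, ← hbase,
    mul_div_cancel_right₀ _ (by nlinarith), hermitianVariety]
  push_cast
  rfl

theorem card_hermitianVariety_inter_zeros_le (hF : Fintype.card F = q ^ 2) (hn : 2 ≤ n)
    (hd : d ≤ q) (hH : IsHermitianMatrix q H) (hrank : H.rank = n)
    (hH' : IsHermitianMatrix q H') (hrank' : H'.rank = n)
    {G : MvPolynomial (Fin (n + 1)) F} (hG : G.IsHomogeneous d) (hG0 : G ≠ 0) :
    (Nat.card ↥(hermitianVariety q H ∩ zeros G) : ℤ) ≤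
      max ((Nat.card (hermitianVariety q H') : ℤ) + ((d : ℤ) - 1) * (q + 1) * q ^ (2 * n - 4))
        (1 + q ^ 2 * (maxSection (hermitianVariety q H') d : ℤ)) := by
  obtain ⟨G', hG', hG'0, hcard⟩ := exists_card_hermitianVariety_inter_zeros_eq hF hH hrank hH'
    hrank' hG hG0 (hd.trans (hF ▸ Nat.le_self_pow two_ne_zero q))
  rw [hcard]
  exact card_hermitianCone_inter_zeros_le hF hn hH' hrank' hG' hd hG'0

theorem card_hermitianVariety_inter_zeros_lt (hF : Fintype.card F = q ^ 2) (hn : 2 ≤ n)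
    (hd : d ≤ q) (hH : IsHermitianMatrix q H) (hrank : H.rank = n)
    (hH' : IsHermitianMatrix q H') (hrank' : H'.rank = n)
    {G : MvPolynomial (Fin (n + 1)) F} (hG : G.IsHomogeneous d) (hG0 : G ≠ 0) :
    Nat.card ↥(hermitianVariety q H ∩ zeros G) < Nat.card (hermitianVariety q H) := by
  have hq := two_le_of_card_eq_sq hF
  have hdF : d < Fintype.card F := hd.trans_lt (hF ▸ lt_self_pow₀ hq one_lt_two)
  obtain ⟨G', hG', hG'0, hcard⟩ :=
    exists_card_hermitianVariety_inter_zeros_eq hF hH hrank hH' hrank' hG hG0 hdF.le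
  obtain ⟨P, hPH, hPG⟩ := exists_mem_hermitianVariety_notMem_zeros hF hn hH' hrank'
    (isHomogeneous_leadingCoeff_finSuccEquiv hG') ((Nat.sub_le _ _).trans hd) (by simpa using hG'0)
  rw [hcard, card_hermitianVariety_eq_card_cone hF hH hrank hH' hrank']
  exact card_cone_inter_zeros_lt isHomogeneous_hermitianForm q.succ_ne_zero hG' hG'0 hdF hPH hPG

end StandardCone

section Code

variable {F : Type*} [Field F]

theorem hammingNorm_evalMap_add_card_inter_zeros [DecidableEq F] {N m d : ℕ}
    {X : Set (ℙ F (Fin N → F))} (e : Fin m ≃ X)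
    (G : MvPolynomial.homogeneousSubmodule (Fin N) F d) :
    hammingNorm (evalMap d (fun i => (e i : ℙ F (Fin N → F))) G) +
      Nat.card ↥(X ∩ zeros (G : MvPolynomial (Fin N) F)) = Nat.card X := by
  have hzeros : Nat.card ↥(X ∩ zeros (G : MvPolynomial (Fin N) F)) =
      (Finset.univ.filter fun i =>
        ¬ evalMap d (fun i => (e i : ℙ F (Fin N → F))) G i ≠ 0).card := by
    rw [← Fintype.card_subtype, ← Nat.card_eq_fintype_card]
    refine Nat.card_congr ((Equiv.subtypeSubtypeEquivSubtypeInter _ _).symm.trans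
      (e.subtypeEquiv fun i => ?_).symm)
    exact not_not
  rw [hzeros, hammingNorm, Finset.card_filter_add_card_filter_not, Finset.card_univ,
    Fintype.card_fin, ← Nat.card_congr e, Nat.card_fin]

theorem exists_hammingNorm_eq_minDist [DecidableEq F] {m : ℕ} {C : Submodule F (Fin m → F)}
    (hC : C ≠ ⊥) : ∃ c ∈ C, c ≠ 0 ∧ hammingNorm c = minDist C := by
  obtain ⟨c, hc, hc0⟩ := Submodule.exists_mem_ne_zero_of_ne_bot hC
  obtain ⟨c', hc', hc'0, hw⟩ := Nat.sInf_mem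
    (s := {w | ∃ c ∈ C, c ≠ 0 ∧ w = hammingNorm c}) ⟨_, c, hc, hc0, rfl⟩
  refine ⟨c', hc', hc'0, hw.symm.trans ?_⟩
  rw [minDist]
  congr!

theorem finrank_homogeneousSubmodule (n d : ℕ) :
    Module.finrank F (MvPolynomial.homogeneousSubmodule (Fin (n + 1)) F d) =
      (n + d).choose d := by
  rw [MvPolynomial.homogeneousSubmodule_eq_finsupp_supported]
  have hcoe : {k : Fin (n + 1) →₀ ℕ | k.degree = d} =
      (Finset.univ.finsuppAntidiag d : Finset (Fin (n + 1) →₀ ℕ)) := by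
    ext k
    simp [Finset.mem_finsuppAntidiag, Finsupp.degree_eq_sum]
  rw [hcoe]
  refine (Module.finrank_eq_card_basis (MvPolynomial.basisRestrictSupport F _)).trans
    ((Fintype.card_coe _).trans ?_)
  rw [Finset.card_finsuppAntidiag_nat_eq_choose, Finset.card_univ,
    Fintype.card_fin, Nat.add_right_comm, Nat.add_sub_cancel]

variable {N m d : ℕ} {X : Set (ℙ F (Fin N → F))}

theorem evalMap_injective (e : Fin m ≃ X)
    (hX : ∀ G : MvPolynomial (Fin N) F, G.IsHomogeneous d → G ≠ 0 →
      Nat.card ↥(X ∩ zeros G) < Nat.card X) :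
    Function.Injective (evalMap d fun i => (e i : ℙ F (Fin N → F))) := by
  classical
  refine (injective_iff_map_eq_zero _).2 fun G hG => ?_
  by_contra hG0
  have hweight := hammingNorm_evalMap_add_card_inter_zeros e G
  have hlt := hX G G.2 (by simpa using hG0)
  rw [hG, hammingNorm_zero, zero_add] at hweight
  exact hlt.ne hweight

theorem card_sub_le_minDist_functionalCode (e : Fin m ≃ X)
    (hcode : functionalCode d X e ≠ ⊥) {b : ℤ}
    (hb : ∀ G : MvPolynomial (Fin N) F, G.IsHomogeneous d → G ≠ 0 →
      (Nat.card ↥(X ∩ zeros G) : ℤ) ≤ b) :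
    (Nat.card X : ℤ) - b ≤ minDist (functionalCode d X e) := by
  classical
  obtain ⟨c, ⟨G, rfl⟩, hc0, hmin⟩ := exists_hammingNorm_eq_minDist hcode
  have hG0 : (G : MvPolynomial (Fin N) F) ≠ 0 := fun h0 =>
    hc0 (by rw [Subtype.ext (a1 := G) (a2 := 0) h0, map_zero])
  have hweight := hammingNorm_evalMap_add_card_inter_zeros e G
  have hbG := hb G G.2 hG0
  rw [← hmin, ← hweight]
  push_cast
  linarith

end Code

end HermitianCode

open HermitianCode in
theorem mainTheorem3 {F : Type*} [Field F] [Fintype F] (q n d m : ℕ)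
    (hF : Fintype.card F = q ^ 2) (hn : 2 ≤ n) (hd : d ≤ q)
    -- a Hermitian variety of rank `n` in `ℙ^n`, with an enumeration of its rational points
    (H : Matrix (Fin (n + 1)) (Fin (n + 1)) F) (hH : IsHermitianMatrix q H) (hrank : H.rank = n)
    (e : Fin m ≃ hermitianVariety q H)
    -- a non-degenerate Hermitian variety in `ℙ^(n-1)`
    (H' : Matrix (Fin n) (Fin n) F) (hH' : IsHermitianMatrix q H') (hrank' : H'.rank = n) :
    m = Nat.card (hermitianVariety q H) ∧
    (m : ℚ) = 1 + (q : ℚ) ^ 2 *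
      (((q : ℚ) ^ (n - 1) - (-1) ^ (n - 1)) * ((q : ℚ) ^ n - (-1) ^ n) / ((q : ℚ) ^ 2 - 1)) ∧
    Module.finrank F (functionalCode d (hermitianVariety q H) e) = (n + d).choose d ∧
    (Nat.card (hermitianVariety q H) : ℤ) -
        max ((Nat.card (hermitianVariety q H') : ℤ) + ((d : ℤ) - 1) * (q + 1) * q ^ (2 * n - 4))
          (1 + q ^ 2 * (maxSection (hermitianVariety q H') d : ℤ))
      ≤ (minDist (functionalCode d (hermitianVariety q H) e) : ℤ) := by
  have hlength : m = Nat.card (hermitianVariety q H) := by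
    rw [← Nat.card_congr e, Nat.card_fin]
  have hdim : Module.finrank F (functionalCode d (hermitianVariety q H) e) =
      (n + d).choose d := by
    rw [functionalCode, LinearMap.finrank_range_of_inj, finrank_homogeneousSubmodule]
    exact evalMap_injective e fun G hG hG0 =>
      card_hermitianVariety_inter_zeros_lt hF hn hd hH hrank hH' hrank' hG hG0
  have hcode : functionalCode d (hermitianVariety q H) e ≠ ⊥ := fun hbot =>
    (Nat.choose_pos (Nat.le_add_left d n)).ne (by rw [← hdim, hbot, finrank_bot])
  refine ⟨hlength, hlength ▸ card_hermitianVariety_eq hF hH hrank hH' hrank', hdim,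
    card_sub_le_minDist_functionalCode e hcode fun G hG hG0 =>
      card_hermitianVariety_inter_zeros_le hF hn hd hH hrank hH' hrank' hG hG0⟩
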